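/- Let $T$ be a tree with vertex set $V$, path metric $d$, and set of oriented edges $E$; write $h_-$ and $h_+$ for the initial and terminal vertex of $h\in E$. For $x\in V$ let $\mathbf 1_x$ be the characteristic function of the set $\{h\in E : d(x,h_+)<d(x,h_-)\}$ of oriented edges pointing towards $x$. Let $G$ be a discrete group acting on $T$ by graph automorphisms without inversion (no $g\in G$ sends an oriented edge to its reverse), let $\pi$ be the unitary representation of $G$ on the complex Hilbert space $\ell^2(E)$ given by $(\pi(g)f)(h)=f(g^{-1}h)$, let $x_0\in V$, and let $b\in Z^1(G,\ell^2(E))$, $b(g)=\mathbf 1_{gx_0}-\mathbf 1_{x_0}$, be the Haagerup cocycle with respect to $x_0$. Let $\overline H^1(G,\ell^2(E))$ denote the reduced first cohomology, that is, the space of $1$-cocycles $c:G\to\ell^2(E)$, $c(gh)=c(g)+\pi(g)c(h)$, modulo the closure, for uniform convergence on compact (that is, finite) subsets of $G$, of the space of coboundaries $g\mapsto \pi(g)v-v$, $v\in\ell^2(E)$. The boundary $\partial T$ is the set of geodesic rays $\mathbb N\to V$ (injective infinite paths) modulo the relation of eventually coinciding up to a shift of the parameter. The action is called elementary if $G$ has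 a finite orbit in $V$ or a finite orbit in $\partial T$. Then $\|b(g)\|^2=2\,d(gx_0,x_0)$ for every $g\in G$, and the class $[b]$ is trivial in $\overline H^1(G,\ell^2(E))$ if and only if the action of $G$ on $T$ is elementary. -/

import Mathlib

open scoped ENNReal

noncomputable section

/-! ### Reduced first cohomology of a unitary representation -/

namespace UnitaryCohomology

variable {G : Type*} [Group G] [TopologicalSpace G]
  {H : Type*} [NormedAddCommGroup H] [InnerProductSpace ℂ H]

/-- Continuous 1-cocycles `c : G → H` of a representation `π` by unitary operators:
`c (g * h) = c g + π g (c h)`.  The space carries the topology induced by the compact-open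
topology of `C(G, H)`, that is, uniform convergence on compact subsets of `G`. -/
def Z1 (π : G →* (H ≃ₗᵢ[ℂ] H)) : Submodule ℂ C(G, H) where
  carrier := {c | ∀ g h, c (g * h) = c g + π g (c h)}
  zero_mem' := by intro g h; simp
  add_mem' := by
    intro c d hc hd g h
    simp only [ContinuousMap.add_apply, hc g h, hd g h, map_add]
    abel
  smul_mem' := by
    intro a c hc g h
    simp only [ContinuousMap.smul_apply, hc g h, map_smul, smul_add]

/-- 1-coboundaries: cocycles of the form `g ↦ π g v - v` for some vector `v`. -/
def B1 (π : G →* (H ≃ₗᵢ[ℂ] H)) : Submodule ℂ (Z1 π) where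
  carrier := {c | ∃ v : H, ∀ g, c.1 g = π g v - v}
  zero_mem' := ⟨0, by intro g; simp⟩
  add_mem' := by
    rintro c d ⟨v, hv⟩ ⟨w, hw⟩
    refine ⟨v + w, fun g => ?_⟩
    simp only [Submodule.coe_add, ContinuousMap.add_apply, hv g, hw g, map_add]
    abel
  smul_mem' := by
    rintro a c ⟨v, hv⟩
    refine ⟨a • v, fun g => ?_⟩
    simp only [Submodule.coe_smul, ContinuousMap.smul_apply, hv g, map_smul, smul_sub]

/-- Reduced first cohomology: cocycles modulo the closure of the coboundaries, the closure being
taken for uniform convergence on compact subsets. -/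
abbrev ReducedH1 (π : G →* (H ≃ₗᵢ[ℂ] H)) : Type _ := Z1 π ⧸ (B1 π).topologicalClosure

/-- The class of a cocycle in reduced first cohomology. -/
def reducedClass (π : G →* (H ≃ₗᵢ[ℂ] H)) (c : Z1 π) : ReducedH1 π :=
  (B1 π).topologicalClosure.mkQ c

end UnitaryCohomology

/-! ### Permutation representations on `ℓ²` -/

/-- The complex Hilbert space `ℓ²(α)`. -/
abbrev EllTwo (α : Type*) : Type _ := lp (fun _ : α => ℂ) 2

/-- The unitary operator on `ℓ²(α)` induced by a permutation `e`: `f ↦ f ∘ e⁻¹`. -/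
def ellTwoPerm {α : Type*} (e : Equiv.Perm α) : EllTwo α ≃ₗᵢ[ℂ] EllTwo α where
  toFun f := ⟨fun a => f (e.symm a), by
    have h := lp.memℓp f
    rw [memℓp_gen_iff (by norm_num)] at h
    exact memℓp_gen (e.symm.summable_iff.2 h)⟩
  invFun f := ⟨fun a => f (e a), by
    have h := lp.memℓp f
    rw [memℓp_gen_iff (by norm_num)] at h
    exact memℓp_gen (e.summable_iff.2 h)⟩
  map_add' _ _ := rfl
  map_smul' _ _ := rfl
  left_inv f := by ext a; simp
  right_inv f := by ext a; simp
  norm_map' f := by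
    rw [lp.norm_eq_tsum_rpow (by norm_num), lp.norm_eq_tsum_rpow (by norm_num)]
    congr 1
    exact e.symm.tsum_eq (fun a => ‖f a‖ ^ (2 : ℝ≥0∞).toReal)

/-- Permutations of `α` act unitarily on `ℓ²(α)`. -/
def ellTwoPermHom (α : Type*) : Equiv.Perm α →* (EllTwo α ≃ₗᵢ[ℂ] EllTwo α) where
  toFun := ellTwoPerm
  map_one' := rfl
  map_mul' _ _ := rfl

namespace TreeAction

variable {V : Type*} {T : SimpleGraph V} {G : Type*} [Group G]

/-! ### Oriented edges -/

/-- The permutation of the oriented edges induced by a graph automorphism. -/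
def dartPerm (T : SimpleGraph V) : (T ≃g T) →* Equiv.Perm T.Dart where
  toFun φ :=
    { toFun := φ.toHom.mapDart
      invFun := φ.symm.toHom.mapDart
      left_inv := fun d => by ext <;> simp
      right_inv := fun d => by ext <;> simp }
  map_one' := rfl
  map_mul' _ _ := rfl

/-- The unitary representation of `G` on `ℓ²` of the oriented edges: `(g f)(h) = f (g⁻¹ h)`. -/
def edgeRep (ρ : G →* (T ≃g T)) : G →* (EllTwo T.Dart ≃ₗᵢ[ℂ] EllTwo T.Dart) :=
  (ellTwoPermHom T.Dart).comp ((dartPerm T).comp ρ)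

/-- The action is without inversion: no group element reverses an edge. -/
def WithoutInversion (ρ : G →* (T ≃g T)) : Prop :=
  ∀ (g : G) (e : T.Dart), dartPerm T (ρ g) e ≠ e.symm

/-! ### The Haagerup cocycle -/

/-- The half-tree of an oriented edge `h`: the vertices nearer to its terminal vertex than to its
initial vertex. -/
def halfTree (h : T.Dart) : Set V := {x | T.dist x h.snd < T.dist x h.fst}

/-- The characteristic function of the set of oriented edges pointing towards `x`, i.e. of the
half-trees that contain `x`. -/
def pointing (x : V) (h : T.Dart) : ℂ := (halfTree h).indicator (fun _ => 1) x

lemma dist_iso (φ : T ≃g T) (x y : V) (hT : T.Connected) :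
    T.dist (φ x) (φ y) = T.dist x y := by
  apply le_antisymm
  · obtain ⟨p, hp⟩ := hT.exists_walk_length_eq_dist x y
    rw [← hp, ← SimpleGraph.Walk.length_map φ.toHom p]
    exact SimpleGraph.dist_le _
  · obtain ⟨p, hp⟩ := hT.exists_walk_length_eq_dist (φ x) (φ y)
    have h := SimpleGraph.dist_le (p.map φ.symm.toHom)
    rw [SimpleGraph.Walk.length_map, hp] at h
    simpa using h

lemma pointing_iso (hT : T.Connected) (φ : T ≃g T) (x : V) (h : T.Dart) :
    pointing (φ x) h = pointing x ((dartPerm T φ).symm h) := by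
  have h1 : ∀ y, T.dist (φ x) y = T.dist x (φ.symm y) := fun y => by
    rw [← dist_iso φ x (φ.symm y) hT]; simp
  have h2 : φ x ∈ halfTree h ↔ x ∈ halfTree ((dartPerm T φ).symm h) := by
    change T.dist (φ x) h.snd < T.dist (φ x) h.fst ↔
      T.dist x (φ.symm h.snd) < T.dist x (φ.symm h.fst)
    rw [h1, h1]
  unfold pointing
  by_cases hx : φ x ∈ halfTree h
  · rw [Set.indicator_of_mem hx, Set.indicator_of_mem (h2.1 hx)]
  · rw [Set.indicator_of_notMem hx, Set.indicator_of_notMem (fun h' => hx (h2.2 h'))]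

/-- Crossing one edge from `u` to `v` leaves the half-tree of `(a, b)` only if that edge is
`(b, a)`. -/
lemma eq_of_crossing (hT : T.IsTree) {u v a b : V} (huv : T.Adj u v) (hab : T.Adj a b)
    (hu : T.dist u b < T.dist u a) (hv : ¬ T.dist v b < T.dist v a) : u = b ∧ v = a := by
  have e1 := hT.dist_eq_dist_add_one_of_adj u hab
  have e2 := hT.dist_eq_dist_add_one_of_adj v hab
  have e3 := hT.dist_eq_dist_add_one_of_adj a huv
  have e4 := hT.dist_eq_dist_add_one_of_adj b huv
  rw [T.dist_comm (u := a) (v := u), T.dist_comm (u := a) (v := v)] at e3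
  rw [T.dist_comm (u := b) (v := u), T.dist_comm (u := b) (v := v)] at e4
  obtain ⟨p, hp⟩ := hT.connected.exists_walk_length_eq_dist a v
  obtain ⟨r, hr⟩ := hT.connected.exists_walk_length_eq_dist b u
  rw [T.dist_comm] at hp hr
  have h1 : (p.concat huv.symm).IsPath := SimpleGraph.Walk.isPath_of_length_eq_dist _ (by
    rw [SimpleGraph.Walk.length_concat, T.dist_comm]; omega)
  have h2 : (SimpleGraph.Walk.cons hab r).IsPath :=
    SimpleGraph.Walk.isPath_of_length_eq_dist _ (by
      rw [SimpleGraph.Walk.length_cons, T.dist_comm]; omega)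
  have h3 := (hT.isAcyclic.subsingleton_path a u).elim ⟨_, h1⟩ ⟨_, h2⟩
  rw [Subtype.mk.injEq] at h3
  cases p with
  | nil =>
    have h0 : T.dist v v = 0 := T.dist_self
    have : T.dist u b = 0 := by omega
    exact ⟨hT.connected.dist_eq_zero_iff.1 this, rfl⟩
  | cons h p' =>
    exfalso
    rw [SimpleGraph.Walk.concat_cons] at h3
    have h4 := congrArg SimpleGraph.Walk.snd h3
    simp only [SimpleGraph.Walk.snd_cons] at h4
    subst h4
    have h5 := SimpleGraph.dist_le p'
    rw [SimpleGraph.Walk.length_cons] at hp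
    rw [T.dist_comm] at h5
    omega

lemma finite_support_adj (hT : T.IsTree) {u v : V} (huv : T.Adj u v) :
    {h : T.Dart | pointing u h - pointing v h ≠ 0}.Finite := by
  refine (Set.toFinite {(⟨(u, v), huv⟩ : T.Dart), ⟨(v, u), huv.symm⟩}).subset ?_
  rintro ⟨⟨a, b⟩, hab⟩ hne
  simp only [Set.mem_ofPred_eq] at hne
  by_cases hu : u ∈ halfTree (⟨(a, b), hab⟩ : T.Dart) <;>
    by_cases hv : v ∈ halfTree (⟨(a, b), hab⟩ : T.Dart)
  · exact absurd (by simp [pointing, hu, hv]) hne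
  · obtain ⟨rfl, rfl⟩ := eq_of_crossing hT huv hab hu hv
    simp
  · obtain ⟨rfl, rfl⟩ := eq_of_crossing hT huv.symm hab hv hu
    simp
  · exact absurd (by simp [pointing, hu, hv]) hne

lemma finite_support (hT : T.IsTree) (u v : V) :
    {h : T.Dart | pointing u h - pointing v h ≠ 0}.Finite := by
  obtain ⟨p⟩ := hT.connected u v
  induction p with
  | nil => simp
  | cons huv p ih =>
    refine ((finite_support_adj hT huv).union ih).subset fun h hh => ?_
    by_contra hcon
    simp only [Set.mem_union, Set.mem_ofPred_eq, not_or, not_not] at hcon hh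
    exact hh (by rw [← sub_add_sub_cancel, hcon.1, hcon.2, add_zero])

/-- The vector `𝟙_y - 𝟙_x` of `ℓ²` of the oriented edges. -/
def pointingDiff (hT : T.IsTree) (y x : V) : EllTwo T.Dart :=
  ⟨fun h => pointing y h - pointing x h,
    (memℓp_zero (finite_support hT y x)).of_exponent_ge zero_le⟩

/-- The Haagerup cocycle with respect to the base vertex `x₀`: `b g = 𝟙_{g x₀} - 𝟙_{x₀}`. -/
def haagerupCocycle [TopologicalSpace G] [DiscreteTopology G] (hT : T.IsTree)
    (ρ : G →* (T ≃g T)) (x₀ : V) : UnitaryCohomology.Z1 (edgeRep ρ) :=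
  ⟨⟨fun g => pointingDiff hT (ρ g x₀) x₀, continuous_of_discreteTopology⟩, by
    intro g h
    ext d
    change pointing (ρ (g * h) x₀) d - pointing x₀ d =
      (pointing (ρ g x₀) d - pointing x₀ d) +
        (pointing (ρ h x₀) ((dartPerm T (ρ g)).symm d) - pointing x₀ ((dartPerm T (ρ g)).symm d))
    rw [← pointing_iso hT.connected, ← pointing_iso hT.connected, map_mul, RelIso.mul_apply]
    ring⟩

/-! ### The boundary of a tree and elementary actions -/

/-- A geodesic ray of a tree: an infinite path that visits each vertex at most once. -/
structure Ray (T : SimpleGraph V) where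
  toFun : ℕ → V
  adj : ∀ n, T.Adj (toFun n) (toFun (n + 1))
  injective : Function.Injective toFun

/-- Two rays are equivalent if they eventually coincide, up to a shift of the parameter. -/
instance Ray.setoid (T : SimpleGraph V) : Setoid (Ray T) where
  r r s := ∃ m n : ℕ, ∀ k, r.toFun (m + k) = s.toFun (n + k)
  iseqv :=
    { refl := fun _ => ⟨0, 0, fun _ => rfl⟩
      symm := fun ⟨m, n, h⟩ => ⟨n, m, fun k => (h k).symm⟩
      trans := fun {r s t} ⟨m, n, h⟩ ⟨p, q, h'⟩ => ⟨m + p, q + n, fun k => by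
        rw [add_assoc, h, add_assoc, ← h']
        congr 1
        omega⟩ }

/-- The boundary `∂T`: equivalence classes of geodesic rays. -/
def Boundary (T : SimpleGraph V) : Type _ := Quotient (Ray.setoid T)

/-- The image of a ray under a graph automorphism. -/
def Ray.map (φ : T ≃g T) (r : Ray T) : Ray T where
  toFun n := φ (r.toFun n)
  adj n := φ.map_adj_iff.2 (r.adj n)
  injective := φ.injective.comp r.injective

/-- The action of graph automorphisms on the boundary. -/
def Boundary.map (φ : T ≃g T) : Boundary T → Boundary T :=
  Quotient.map (Ray.map φ) fun _ _ ⟨m, n, h⟩ => ⟨m, n, fun k => congrArg φ (h k)⟩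

/-- The action is elementary: `G` has a finite orbit in `T` or in `∂T`. -/
def IsElementary (ρ : G →* (T ≃g T)) : Prop :=
  (∃ v : V, (Set.range fun g : G => ρ g v).Finite) ∨
    ∃ ξ : Boundary T, (Set.range fun g : G => Boundary.map (ρ g) ξ).Finite

end TreeAction

end

noncomputable section

namespace TreeAction

variable {V : Type*} {T : SimpleGraph V} {G : Type*} [Group G]

/-! ### Half-trees -/

/-! The function 𝟙_y - 𝟙_x is ±1 on both orientations of each edge between x and y and 0 elsewhere,
whence the norm formula (`norm_sq_pointingDiff`).

If the action is elementary: `b` is formally the coboundary of 𝟙_{x₀}, which need not be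
square-summable. Subtracting the mean of 𝟙_{r(n)}, n < N, along a ray r towards a fixed end gives a
vector of ℓ². The error is the mean of 𝟙_{g r(n)} - 𝟙_{r(n)}; this telescopes to boundedly many
terms of norm at most √(2N), divided by N (`norm_sum_pointingDiff_shift_le`). A finite orbit is
handled by averaging over it as well.

Conversely, suppose first that no element maps a half-tree properly into itself. Apart from the case
of a fixed edge, the half-trees containing a translate of their own complement form an invariant
orientation, whose sink or end is fixed (`isElementary_of_not_skewers`). Otherwise some a skewers an
edge h. The strip between h and ah is wandering, so almost invariant vectors have little mass there.
If the action is not elementary, some element moves the attracting end of a off both ends of a,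
hence carries a deep translate of h into a strip; so h, and likewise its complement, is negligible
(`Skewers.negligible_halfTree`). This amounts to a spectral gap: a trivial reduced class would make
`b` bounded, against the unbounded displacement of the powers of a. -/

lemma mem_halfTree {h : T.Dart} {x : V} : x ∈ halfTree h ↔ T.dist x h.snd < T.dist x h.fst :=
  Iff.rfl

lemma snd_mem_halfTree (h : T.Dart) : h.snd ∈ halfTree h := by
  rw [mem_halfTree, T.dist_self]
  have := SimpleGraph.dist_eq_one_iff_adj.2 h.adj
  rw [T.dist_comm] at this
  omega

lemma fst_notMem_halfTree (h : T.Dart) : h.fst ∉ halfTree h := by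
  rw [mem_halfTree, T.dist_self]
  omega

lemma mem_halfTree_symm (hT : T.IsTree) {h : T.Dart} {x : V} :
    x ∈ halfTree h.symm ↔ x ∉ halfTree h := by
  rw [mem_halfTree, mem_halfTree]
  have := hT.dist_eq_dist_add_one_of_adj x h.adj
  change T.dist x h.fst < T.dist x h.snd ↔ _
  omega

/-- An edge leaving a half-tree is the reverse of the edge that defines it. -/
lemma eq_of_exit (hT : T.IsTree) {h : T.Dart} {u v : V} (huv : T.Adj u v)
    (hu : u ∈ halfTree h) (hv : v ∉ halfTree h) : u = h.snd ∧ v = h.fst :=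
  eq_of_crossing hT huv h.adj hu hv

lemma exists_adj_closer (hT : T.IsTree) {x y : V} (hxy : x ≠ y) :
    ∃ z, T.Adj x z ∧ T.dist z y < T.dist x y := by
  obtain ⟨p, hp⟩ := hT.connected.exists_walk_length_eq_dist x y
  cases p with
  | nil => exact absurd rfl hxy
  | cons h q =>
    refine ⟨_, h, ?_⟩
    have := SimpleGraph.dist_le q
    rw [SimpleGraph.Walk.length_cons] at hp
    omega

/-- A property that is constant along the edges inside a half-tree is constant on it. -/
lemma halfTree_induction (hT : T.IsTree) {f : T.Dart} {P : V → Prop}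
    (hP : ∀ u v, T.Adj u v → u ∈ halfTree f → v ∈ halfTree f → P u → P v)
    {z : V} (hz : z ∈ halfTree f) : P z ↔ P f.snd := by
  induction hn : T.dist z f.snd using Nat.strong_induction_on generalizing z with
  | _ n ih =>
    by_cases hzf : z = f.snd
    · rw [hzf]
    obtain ⟨w, hzw, hw⟩ := exists_adj_closer hT hzf
    have hwf : w ∈ halfTree f := by
      by_contra hcon
      exact hzf (eq_of_exit hT hzw hz hcon).1
    rw [← ih _ (hn ▸ hw) hwf rfl]
    exact ⟨hP z w hzw hz hwf, hP w z hzw.symm hwf hz⟩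

/-- The only edge leaving the half-tree of `e` ends at `e.fst`, which lies outside the half-tree of
`f`; so no edge inside the latter crosses `e`. -/
lemma mem_halfTree_iff_of_fst_notMem (hT : T.IsTree) {e f : T.Dart} (he : e.fst ∉ halfTree f)
    {z : V} (hz : z ∈ halfTree f) : z ∈ halfTree e ↔ f.snd ∈ halfTree e := by
  refine halfTree_induction hT (P := fun z => z ∈ halfTree e) (fun u v huv _ hv hue => ?_) hz
  by_contra hve
  exact he ((eq_of_exit hT huv hue hve).2 ▸ hv)

lemma halfTree_subset (hT : T.IsTree) {e f : T.Dart} (he : e.fst ∉ halfTree f) {z : V}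
    (hz : z ∈ halfTree f) (hze : z ∈ halfTree e) : halfTree f ⊆ halfTree e := fun _ hw =>
  (mem_halfTree_iff_of_fst_notMem hT he hw).2 ((mem_halfTree_iff_of_fst_notMem hT he hz).1 hze)

lemma halfTree_subset_or (hT : T.IsTree) {e f : T.Dart} (he : e.fst ∉ halfTree f) :
    halfTree f ⊆ halfTree e ∨ halfTree f ⊆ halfTree e.symm := by
  by_cases h : f.snd ∈ halfTree e
  · exact Or.inl (halfTree_subset hT he (snd_mem_halfTree f) h)
  · refine Or.inr fun z hz => (mem_halfTree_symm hT).2 fun hze => h ?_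
    exact (mem_halfTree_iff_of_fst_notMem hT he hz).1 hze

/-- Any two half-trees are nested, up to replacing them by their complements. -/
lemma halfTree_nested (hT : T.IsTree) (e f : T.Dart) :
    halfTree f ⊆ halfTree e ∨ halfTree f ⊆ halfTree e.symm ∨
      halfTree f.symm ⊆ halfTree e ∨ halfTree f.symm ⊆ halfTree e.symm := by
  by_cases he : e.fst ∈ halfTree f
  · have := halfTree_subset_or hT (e := e) (f := f.symm)
      (fun h => (mem_halfTree_symm hT).1 h he)
    tauto
  · have := halfTree_subset_or hT he
    tauto

lemma halfTree_injective (hT : T.IsTree) : Function.Injective (halfTree : T.Dart → Set V) := by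
  intro e f h
  have := eq_of_exit hT (h := f) e.adj.symm (h ▸ snd_mem_halfTree e) (h ▸ fst_notMem_halfTree e)
  exact SimpleGraph.Dart.ext _ _ (Prod.ext this.2 this.1)

lemma halfTree_symm_subset_symm (hT : T.IsTree) {e f : T.Dart} :
    halfTree e.symm ⊆ halfTree f.symm ↔ halfTree f ⊆ halfTree e := by
  constructor
  · intro h x hx
    by_contra hc
    exact (mem_halfTree_symm hT).1 (h ((mem_halfTree_symm hT).2 hc)) hx
  · intro h x hx
    exact (mem_halfTree_symm hT).2 fun hc => (mem_halfTree_symm hT).1 hx (h hc)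

/-! ### Consistent orientations -/

/-- A consistent orientation of a tree: at least one orientation of each edge is chosen, and any
two chosen half-trees meet. -/
structure IsOrientation (O : Set T.Dart) : Prop where
  total : ∀ h, h ∈ O ∨ h.symm ∈ O
  meet : ∀ h ∈ O, ∀ k ∈ O, (halfTree h ∩ halfTree k).Nonempty

namespace IsOrientation

variable {O : Set T.Dart}

lemma symm_notMem (hO : IsOrientation O) (hT : T.IsTree) {h : T.Dart} (hh : h ∈ O) :
    h.symm ∉ O := fun hs => by
  obtain ⟨x, hx, hx'⟩ := hO.meet h hh _ hs
  exact (mem_halfTree_symm hT).1 hx' hx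

/-- Half-trees pointing away from the same vertex contain each other as soon as they meet. -/
lemma eq_of_fst_eq (hO : IsOrientation O) (hT : T.IsTree) {h k : T.Dart} (hh : h ∈ O)
    (hk : k ∈ O) (hhk : h.fst = k.fst) : h = k := by
  obtain ⟨z, hz, hz'⟩ := hO.meet h hh k hk
  have h1 := halfTree_subset hT (hhk ▸ fst_notMem_halfTree k) hz' hz
  have h2 := halfTree_subset hT (hhk ▸ fst_notMem_halfTree h) hz hz'
  exact halfTree_injective hT (h2.antisymm h1)

open Classical in
/-- The terminal vertex of the chosen edge that starts at `x`, or `x` itself if there is none. -/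
def next (O : Set T.Dart) (x : V) : V :=
  if h : ∃ d ∈ O, d.fst = x then h.choose.snd else x

lemma next_fst (hO : IsOrientation O) (hT : T.IsTree) {d : T.Dart} (hd : d ∈ O) :
    next O d.fst = d.snd := by
  have h : ∃ e ∈ O, e.fst = d.fst := ⟨d, hd, rfl⟩
  rw [next, dif_pos h, hO.eq_of_fst_eq hT h.choose_spec.1 hd h.choose_spec.2]

lemma next_of_sink {x : V} (h : ¬ ∃ d ∈ O, d.fst = x) : next O x = x := dif_neg h

/-- Adjacent vertices have forward orbits under `next` that differ by one step, since one of the two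
is the `next` of the other. -/
lemma exists_iterate_next_eq (hO : IsOrientation O) (hT : T.IsTree) (x y : V) :
    ∃ i j, (next O)^[i] x = (next O)^[j] y := by
  obtain ⟨p⟩ := hT.connected x y
  induction p with
  | nil => exact ⟨0, 0, rfl⟩
  | @cons u v w huv p ih =>
    obtain ⟨i, j, hij⟩ := ih
    rcases hO.total ⟨(u, v), huv⟩ with h | h
    · refine ⟨i + 1, j, ?_⟩
      rw [Function.iterate_succ_apply, ← hij]
      exact congrArg _ (hO.next_fst hT h)
    · refine ⟨i, j + 1, ?_⟩
      rw [Function.iterate_succ_apply', ← hij, ← Function.iterate_succ_apply' (next O),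
        Function.iterate_succ_apply]
      exact congrArg _ (hO.next_fst hT h).symm

end IsOrientation

/-! ### Rays -/

/-- The `n`-th edge of a ray. -/
def Ray.dart (r : Ray T) (n : ℕ) : T.Dart := ⟨(r.toFun n, r.toFun (n + 1)), r.adj n⟩

lemma Ray.mem_halfTree_dart (r : Ray T) (hT : T.IsTree) {n m : ℕ} (h : n < m) :
    r.toFun m ∈ halfTree (r.dart n) := by
  induction m, h using Nat.le_induction with
  | base => exact snd_mem_halfTree (r.dart n)
  | succ m hm ih =>
    by_contra hcon
    have := r.injective (eq_of_exit hT (r.adj m) ih hcon).2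
    omega

/-- A ray eventually stays on one side of every edge. -/
lemma Ray.eventually_or (r : Ray T) (hT : T.IsTree) (e : T.Dart) :
    (∀ᶠ n in Filter.atTop, r.toFun n ∈ halfTree e) ∨
      ∀ᶠ n in Filter.atTop, r.toFun n ∈ halfTree e.symm := by
  have hfin : (r.toFun ⁻¹' {e.fst, e.snd}).Finite :=
    Set.Finite.preimage r.injective.injOn (Set.toFinite _)
  obtain ⟨N, hN⟩ := hfin.bddAbove
  have key : ∀ d : T.Dart, (d = e ∨ d = e.symm) → ∀ n, N < n → r.toFun n ∈ halfTree d →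
      ∀ m, n ≤ m → r.toFun m ∈ halfTree d := by
    intro d hd n hn hmem m hm
    induction m, hm using Nat.le_induction with
    | base => exact hmem
    | succ m hm ih =>
      by_contra hcon
      have h1 := (eq_of_exit hT (r.adj m) ih hcon).1
      have h2 : m ∈ r.toFun ⁻¹' {e.fst, e.snd} := by
        rcases hd with rfl | rfl
        · simp [h1]
        · rw [Set.mem_preimage, h1]
          exact Or.inl rfl
      have := hN h2
      omega
  by_cases h : r.toFun (N + 1) ∈ halfTree e
  · exact Or.inl (Filter.eventually_atTop.2 ⟨N + 1, key e (Or.inl rfl) _ N.lt_succ_self h⟩)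
  · exact Or.inr (Filter.eventually_atTop.2 ⟨N + 1, key e.symm (Or.inr rfl) _ N.lt_succ_self
      ((mem_halfTree_symm hT).2 h)⟩)

/-- A ray follows an orientation if all its edges are chosen. -/
def Ray.Follows (r : Ray T) (O : Set T.Dart) : Prop := ∀ n, r.dart n ∈ O

namespace IsOrientation

variable {O : Set T.Dart}

lemma exists_ray (hO : IsOrientation O) (hT : T.IsTree) (hs : ∀ x, ∃ d ∈ O, d.fst = x) (x : V) :
    ∃ r : Ray T, r.Follows O := by
  choose d hdO hd using hs
  have hnext : ∀ y, (d y).snd = next O y := fun y => by rw [← hO.next_fst hT (hdO y), hd]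
  have hadj : ∀ y, T.Adj y (next O y) := fun y => by
    have := (d y).adj
    rwa [hd, hnext] at this
  let s : ℕ → V := fun n => (next O)^[n] x
  have hsadj : ∀ n, T.Adj (s n) (s (n + 1)) := fun n => by
    simpa only [s, Function.iterate_succ_apply'] using hadj (s n)
  have hsO : ∀ n, (⟨(s n, s (n + 1)), hsadj n⟩ : T.Dart) ∈ O := fun n => by
    have : (⟨(s n, s (n + 1)), hsadj n⟩ : T.Dart) = d (s n) := by
      refine SimpleGraph.Dart.ext _ _ (Prod.ext (hd _).symm ?_)
      change s (n + 1) = (d (s n)).snd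
      rw [hnext]
      exact Function.iterate_succ_apply' _ _ _
    exact this ▸ hdO (s n)
  -- The path never leaves a half-tree that it has entered: it would have to use the reverse of a
  -- chosen edge.
  have hmem : ∀ n m, n < m → s m ∈ halfTree (⟨(s n, s (n + 1)), hsadj n⟩ : T.Dart) := by
    intro n m h
    induction m, h using Nat.le_induction with
    | base => exact snd_mem_halfTree (⟨(s n, s (n + 1)), hsadj n⟩ : T.Dart)
    | succ m hm ih =>
      by_contra hcon
      obtain ⟨h1, h2⟩ := eq_of_exit hT (hsadj m) ih hcon
      have : (⟨(s m, s (m + 1)), hsadj m⟩ : T.Dart).symm = ⟨(s n, s (n + 1)), hsadj n⟩ :=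
        SimpleGraph.Dart.ext _ _ (Prod.ext h2 h1)
      exact hO.symm_notMem hT (hsO m) (this ▸ hsO n)
  have hinj : Function.Injective s := by
    refine Function.Injective.of_lt_imp_ne fun n m h heq => ?_
    have := hmem n m h
    rw [← heq] at this
    exact fst_notMem_halfTree _ this
  exact ⟨⟨s, hsadj, hinj⟩, hsO⟩

lemma ray_equiv (hO : IsOrientation O) (hT : T.IsTree) {r s : Ray T} (hr : r.Follows O)
    (hs : s.Follows O) : r ≈ s := by
  have key : ∀ t : Ray T, t.Follows O → ∀ m k, t.toFun (m + k) = (next O)^[m + k] (t.toFun 0) := by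
    intro t ht m k
    induction m + k with
    | zero => rfl
    | succ n ih =>
      rw [Function.iterate_succ_apply', ← ih]
      exact (hO.next_fst hT (ht n)).symm
  obtain ⟨i, j, hij⟩ := hO.exists_iterate_next_eq hT (r.toFun 0) (s.toFun 0)
  refine ⟨i, j, fun k => ?_⟩
  rw [key r hr, key s hs, add_comm i, add_comm j, Function.iterate_add_apply, hij,
    Function.iterate_add_apply]

/-- Otherwise the ray ends up in the complement of `h`. The half-tree of each later edge meets that
of `h`, hence contains it, and the distance to `h.snd` would decrease forever. -/
lemma eventually_mem (hO : IsOrientation O) (hT : T.IsTree) {r : Ray T} (hr : r.Follows O)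
    {h : T.Dart} (hh : h ∈ O) : ∀ᶠ n in Filter.atTop, r.toFun n ∈ halfTree h := by
  refine (r.eventually_or hT h).resolve_right fun hev => ?_
  obtain ⟨N, hN⟩ := Filter.eventually_atTop.1 hev
  have hlt : ∀ n, N ≤ n → T.dist (r.toFun (n + 1)) h.snd < T.dist (r.toFun n) h.snd := by
    intro n hn
    obtain ⟨z, hz, hz'⟩ := hO.meet _ (hr n) _ hh
    have := halfTree_subset hT (e := r.dart n) ((mem_halfTree_symm hT).1 (hN n hn)) hz' hz
      (snd_mem_halfTree h)
    rw [mem_halfTree, T.dist_comm, T.dist_comm (u := h.snd)] at this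
    exact this
  have : ∀ k, T.dist (r.toFun (N + k)) h.snd + k ≤ T.dist (r.toFun N) h.snd := by
    intro k
    induction k with
    | zero => rfl
    | succ k ih =>
      have := hlt (N + k) (Nat.le_add_right _ _)
      rw [add_assoc] at this
      omega
  have := this (T.dist (r.toFun N) h.snd + 1)
  omega

end IsOrientation

/-! ### The action on half-trees and on the boundary -/

lemma mem_halfTree_dartPerm (hT : T.IsTree) (φ : T ≃g T) (h : T.Dart) (x : V) :
    φ x ∈ halfTree (dartPerm T φ h) ↔ x ∈ halfTree h := by
  rw [mem_halfTree, mem_halfTree]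
  change T.dist (φ x) (φ h.snd) < T.dist (φ x) (φ h.fst) ↔ _
  rw [dist_iso _ _ _ hT.connected, dist_iso _ _ _ hT.connected]

lemma halfTree_dartPerm (hT : T.IsTree) (φ : T ≃g T) (h : T.Dart) :
    halfTree (dartPerm T φ h) = φ '' halfTree h := by
  ext y
  obtain ⟨x, rfl⟩ := φ.surjective y
  rw [mem_halfTree_dartPerm hT, φ.injective.mem_set_image]

lemma halfTree_dartPerm_subset (hT : T.IsTree) (φ : T ≃g T) {h k : T.Dart} :
    halfTree (dartPerm T φ h) ⊆ halfTree (dartPerm T φ k) ↔ halfTree h ⊆ halfTree k := by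
  rw [halfTree_dartPerm hT, halfTree_dartPerm hT, Set.image_subset_image_iff φ.injective]

lemma dartPerm_symm (φ : T ≃g T) (h : T.Dart) :
    dartPerm T φ h.symm = (dartPerm T φ h).symm := rfl

lemma dartPerm_mul_apply (ρ : G →* (T ≃g T)) (g k : G) (h : T.Dart) :
    dartPerm T (ρ (g * k)) h = dartPerm T (ρ g) (dartPerm T (ρ k) h) := by
  rw [map_mul, map_mul]
  rfl

lemma dartPerm_one_apply (ρ : G →* (T ≃g T)) (h : T.Dart) : dartPerm T (ρ 1) h = h := by
  rw [map_one, map_one]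
  rfl

/-- `g` maps the half-tree of `h` properly into itself. -/
def Skewers (ρ : G →* (T ≃g T)) (g : G) (h : T.Dart) : Prop :=
  halfTree (dartPerm T (ρ g) h) ⊂ halfTree h

lemma skewers_of_subset (hT : T.IsTree) {ρ : G →* (T ≃g T)} {g : G} {h : T.Dart}
    (hsub : halfTree (dartPerm T (ρ g) h) ⊆ halfTree h) (hne : dartPerm T (ρ g) h ≠ h) :
    Skewers ρ g h :=
  hsub.ssubset_of_ne fun heq => hne (halfTree_injective hT heq)

lemma IsOrientation.next_equivariant {O : Set T.Dart} (hO : IsOrientation O) (hT : T.IsTree)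
    {ρ : G →* (T ≃g T)} (hinv : ∀ g, ∀ h ∈ O, dartPerm T (ρ g) h ∈ O) (g : G) (x : V) :
    next O (ρ g x) = ρ g (next O x) := by
  by_cases hx : ∃ d ∈ O, d.fst = x
  · obtain ⟨d, hd, rfl⟩ := hx
    rw [hO.next_fst hT hd]
    exact hO.next_fst hT (hinv g d hd)
  · rw [next_of_sink hx, next_of_sink]
    rintro ⟨d, hd, hdx⟩
    refine hx ⟨_, hinv g⁻¹ d hd, ?_⟩
    change ρ g⁻¹ d.fst = x
    rw [hdx, ← RelIso.mul_apply, ← map_mul, inv_mul_cancel, map_one]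
    rfl

/-- A group that preserves a consistent orientation fixes a vertex or an end. -/
lemma IsOrientation.isElementary {O : Set T.Dart} (hO : IsOrientation O) (hT : T.IsTree)
    {ρ : G →* (T ≃g T)} (hinv : ∀ g, ∀ h ∈ O, dartPerm T (ρ g) h ∈ O) (x₀ : V) :
    IsElementary ρ := by
  by_cases hs : ∀ x, ∃ d ∈ O, d.fst = x
  · obtain ⟨r, hr⟩ := hO.exists_ray hT hs x₀
    refine Or.inr ⟨⟦r⟧, (Set.finite_singleton ⟦r⟧).subset ?_⟩
    rintro _ ⟨g, rfl⟩
    exact Quotient.sound (hO.ray_equiv hT (fun n => hinv g _ (hr n)) hr)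
  · push Not at hs
    obtain ⟨x, hx⟩ := hs
    have hnx : next O x = x := next_of_sink (by simpa using hx)
    refine Or.inl ⟨x, (Set.finite_singleton x).subset ?_⟩
    rintro _ ⟨g, rfl⟩
    -- Both `x` and its image are fixed by `next`, so their merging orbits force them to be equal.
    obtain ⟨i, j, hij⟩ := hO.exists_iterate_next_eq hT (ρ g x) x
    rwa [Function.iterate_fixed hnx, Function.iterate_fixed] at hij
    rw [hO.next_equivariant hT hinv, hnx]

/-- An action without inversion in which no element translates is elementary. -/
lemma isElementary_of_not_skewers (hT : T.IsTree) {ρ : G →* (T ≃g T)} (hρ : WithoutInversion ρ)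
    (hsk : ∀ g h, ¬ Skewers ρ g h) (x₀ : V) : IsElementary ρ := by
  by_cases hfix : ∃ h : T.Dart, ∀ g, dartPerm T (ρ g) h = h
  · obtain ⟨h, hh⟩ := hfix
    refine Or.inl ⟨h.fst, (Set.finite_singleton h.fst).subset ?_⟩
    rintro _ ⟨g, rfl⟩
    exact congrArg (fun d : T.Dart => d.fst) (hh g)
  push Not at hfix
  -- Of the four nestings of `h` with a translate that differs from it, two would give a skewering;
  -- the other two put `h` or its reverse into `O`.
  let O : Set T.Dart := {h | ∃ g, halfTree (dartPerm T (ρ g) h.symm) ⊆ halfTree h}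
  refine IsOrientation.isElementary (O := O) ⟨fun h => ?_, ?_⟩ hT ?_ x₀
  · obtain ⟨g, hg⟩ := hfix h
    rcases halfTree_nested hT h (dartPerm T (ρ g) h) with h1 | h1 | h1 | h1
    · exact absurd (skewers_of_subset hT h1 hg) (hsk _ _)
    · exact Or.inr ⟨g, by rwa [SimpleGraph.Dart.symm_symm]⟩
    · exact Or.inl ⟨g, h1⟩
    · refine absurd (skewers_of_subset hT (h := h.symm) h1 fun h2 => hg ?_) (hsk _ _)
      exact SimpleGraph.Dart.symm_involutive.injective h2
  · rintro h ⟨g, hg⟩ k ⟨g', hg'⟩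
    by_contra hcon
    rw [Set.not_nonempty_iff_eq_empty, ← Set.disjoint_iff_inter_eq_empty,
      Set.disjoint_left] at hcon
    have hhk : halfTree h ⊆ halfTree k.symm := fun x hx => (mem_halfTree_symm hT).2 (hcon hx)
    have hkh : halfTree k ⊆ halfTree h.symm := fun x hx =>
      (mem_halfTree_symm hT).2 fun hx' => hcon hx' hx
    -- With * for reversal, disjointness gives gg'k* ⊆ gh* ⊆ h ⊆ k*. A proper inclusion is a
    -- skewering; equality forces gh* = h, an inversion.
    have h1 : halfTree (dartPerm T (ρ (g * g')) k.symm) ⊆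
        halfTree (dartPerm T (ρ g) h.symm) := by
      rw [dartPerm_mul_apply, halfTree_dartPerm_subset hT]
      exact hg'.trans hkh
    refine hsk (g * g') k.symm (skewers_of_subset hT ((h1.trans hg).trans hhk) fun heq => ?_)
    rw [heq] at h1
    have h2 : dartPerm T (ρ g) h.symm = h :=
      halfTree_injective hT (hg.antisymm (hhk.trans h1))
    exact hρ g h.symm (by rw [h2, SimpleGraph.Dart.symm_symm])
  · rintro g h ⟨k, hk⟩
    refine ⟨g * k * g⁻¹, ?_⟩
    rw [dartPerm_mul_apply, dartPerm_mul_apply, ← dartPerm_symm, ← dartPerm_mul_apply ρ g⁻¹,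
      inv_mul_cancel, dartPerm_one_apply, halfTree_dartPerm_subset hT]
    exact hk

end TreeAction

/-! ### Reduced classes and approximation by coboundaries -/

namespace UnitaryCohomology

variable {G : Type*} [Group G] [TopologicalSpace G]
  {H : Type*} [NormedAddCommGroup H] [InnerProductSpace ℂ H]

lemma reducedClass_eq_zero_iff (π : G →* (H ≃ₗᵢ[ℂ] H)) (c : Z1 π) :
    reducedClass π c = 0 ↔ c ∈ closure (B1 π : Set (Z1 π)) :=
  Submodule.Quotient.mk_eq_zero _

lemma exists_norm_sub_lt_of_reducedClass_eq_zero {π : G →* (H ≃ₗᵢ[ℂ] H)} {c : Z1 π}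
    (hc : reducedClass π c = 0) (F : Finset G) {ε : ℝ} (hε : 0 < ε) :
    ∃ v : H, ∀ g ∈ F, ‖c.1 g - (π g v - v)‖ < ε := by
  rw [reducedClass_eq_zero_iff] at hc
  have hopen : IsOpen (⋂ g ∈ F, {d : Z1 π | ‖c.1 g - d.1 g‖ < ε}) := by
    refine isOpen_biInter_finset fun g _ => isOpen_lt ?_ continuous_const
    exact (continuous_const.sub
      ((continuous_eval_const g).comp continuous_subtype_val)).norm
  obtain ⟨d, hd, v, hv⟩ := mem_closure_iff.1 hc _ hopen (by simp [hε])
  refine ⟨v, fun g hg => ?_⟩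
  rw [← hv]
  exact Set.mem_iInter₂.1 hd g hg

/-- On a discrete group, uniform convergence on compact sets is pointwise convergence. -/
lemma reducedClass_eq_zero_of_tendsto [DiscreteTopology G] {π : G →* (H ≃ₗᵢ[ℂ] H)} {c : Z1 π}
    (v : ℕ → H) (hv : ∀ g, Filter.Tendsto (fun n => π g (v n) - v n) Filter.atTop (nhds (c.1 g))) :
    reducedClass π c = 0 := by
  rw [reducedClass_eq_zero_iff]
  let d : ℕ → Z1 π := fun n => ⟨⟨fun g => π g (v n) - v n, continuous_of_discreteTopology⟩, by
    intro g h
    change π (g * h) (v n) - v n = (π g (v n) - v n) + π g (π h (v n) - v n)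
    rw [map_sub, map_mul, LinearIsometryEquiv.coe_mul, Function.comp_apply]
    abel⟩
  refine mem_closure_of_tendsto (f := d) (b := Filter.atTop) ?_
    (Filter.Eventually.of_forall fun n => ⟨v n, fun g => rfl⟩)
  rw [tendsto_subtype_rng,
    (ContinuousMap.homeoFnOfDiscrete (X := G) (Y := H)).isInducing.tendsto_nhds_iff,
    tendsto_pi_nhds]
  exact hv

end UnitaryCohomology

/-! ### Restriction of functions in `ℓ²` -/

section EllTwo

variable {α : Type*}

lemma EllTwo.summable_norm_sq (f : EllTwo α) : Summable fun a => ‖f a‖ ^ 2 := by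
  have h := lp.memℓp f
  rw [memℓp_gen_iff (by norm_num)] at h
  simpa using h

lemma EllTwo.norm_sq_eq_tsum (f : EllTwo α) : ‖f‖ ^ 2 = ∑' a, ‖f a‖ ^ 2 := by
  have := lp.norm_rpow_eq_tsum (p := 2) (by norm_num) f
  simpa using this

/-- The restriction of `f` to a set, extended by zero. -/
def EllTwo.restrict (S : Set α) (f : EllTwo α) : EllTwo α :=
  ⟨S.indicator f, by
    refine memℓp_gen ?_
    have h := f.summable_norm_sq
    refine Summable.of_nonneg_of_le (fun a => by positivity) (fun a => ?_) h
    simp only [ENNReal.toReal_ofNat, Real.rpow_ofNat]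
    gcongr
    exact norm_indicator_le_norm_self _ _⟩

lemma EllTwo.restrict_apply (S : Set α) (f : EllTwo α) (a : α) :
    EllTwo.restrict S f a = S.indicator f a := rfl

lemma EllTwo.restrict_sub (S : Set α) (f g : EllTwo α) :
    EllTwo.restrict S (f - g) = EllTwo.restrict S f - EllTwo.restrict S g := by
  ext a
  exact congrFun (Set.indicator_sub' S f g) a

lemma EllTwo.sum_norm_restrict_sq_le (f : EllTwo α) {ι : Type*} (s : Finset ι) (S : ι → Set α)
    (hS : (s : Set ι).PairwiseDisjoint S) : ∑ i ∈ s, ‖EllTwo.restrict (S i) f‖ ^ 2 ≤ ‖f‖ ^ 2 := by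
  simp_rw [EllTwo.norm_sq_eq_tsum]
  rw [← Summable.tsum_finsetSum fun i _ => EllTwo.summable_norm_sq _]
  refine Summable.tsum_le_tsum (fun a => ?_)
    (summable_sum fun i _ => EllTwo.summable_norm_sq _) f.summable_norm_sq
  have h : ∀ i, ‖EllTwo.restrict (S i) f a‖ ^ 2 = (S i).indicator (fun a => ‖f a‖ ^ 2) a := by
    intro i
    by_cases ha : a ∈ S i <;> simp [EllTwo.restrict_apply, ha]
  simp_rw [h]
  rw [← Finset.indicator_biUnion_apply s S hS]
  exact Set.indicator_le_self' (fun _ _ => by positivity) a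

lemma EllTwo.norm_restrict_le (S : Set α) (f : EllTwo α) : ‖EllTwo.restrict S f‖ ≤ ‖f‖ := by
  have := f.sum_norm_restrict_sq_le {()} (fun _ => S) (by simp)
  rw [Finset.sum_singleton] at this
  exact le_of_sq_le_sq this (norm_nonneg f)

lemma EllTwo.norm_restrict_mono {S S' : Set α} (h : S ⊆ S') (f : EllTwo α) :
    ‖EllTwo.restrict S f‖ ≤ ‖EllTwo.restrict S' f‖ := by
  have : EllTwo.restrict S f = EllTwo.restrict S (EllTwo.restrict S' f) := by
    ext a
    change S.indicator f a = S.indicator (S'.indicator f) a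
    rw [Set.indicator_indicator, Set.inter_eq_left.2 h]
  rw [this]
  exact EllTwo.norm_restrict_le _ _

lemma EllTwo.norm_restrict_union_le (S S' : Set α) (f : EllTwo α) :
    ‖EllTwo.restrict (S ∪ S') f‖ ≤ ‖EllTwo.restrict S f‖ + ‖EllTwo.restrict S' f‖ := by
  have : EllTwo.restrict (S ∪ S') f = EllTwo.restrict S f + EllTwo.restrict (S' \ S) f := by
    ext a
    change (S ∪ S').indicator f a = S.indicator f a + (S' \ S).indicator f a
    rw [← Set.union_sdiff_self]
    exact congrFun (Set.indicator_union_of_disjoint Set.disjoint_sdiff_right f) a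
  rw [this]
  exact (norm_add_le _ _).trans (by gcongr; exact EllTwo.norm_restrict_mono Set.sdiff_subset f)

end EllTwo

namespace TreeAction

variable {V : Type*} {T : SimpleGraph V} {G : Type*} [Group G]

/-! ### The norm of the Haagerup cocycle -/

lemma pointingDiff_apply (hT : T.IsTree) (y x : V) (d : T.Dart) :
    pointingDiff hT y x d = pointing y d - pointing x d := rfl

lemma pointingDiff_self (hT : T.IsTree) (x : V) : pointingDiff hT x x = 0 := by
  ext d
  exact sub_self (pointing x d)

lemma pointingDiff_sub (hT : T.IsTree) (x y z : V) :
    pointingDiff hT y x - pointingDiff hT z x = pointingDiff hT y z := by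
  ext d
  change (pointing y d - pointing x d) - (pointing z d - pointing x d) =
    pointing y d - pointing z d
  ring

/-- The auxiliary base point `x` splits the sum into two sums of ℓ² vectors that can be reindexed
separately. -/
lemma sum_pointingDiff (hT : T.IsTree) (x : V) {ι : Type*} (s : Finset ι) (u v : ι → V) :
    ∑ i ∈ s, pointingDiff hT (u i) (v i) =
      ∑ i ∈ s, pointingDiff hT (u i) x - ∑ i ∈ s, pointingDiff hT (v i) x := by
  rw [← Finset.sum_sub_distrib]
  exact Finset.sum_congr rfl fun i _ => (pointingDiff_sub hT x _ _).symm

lemma edgeRep_pointingDiff (hT : T.IsTree) (ρ : G →* (T ≃g T)) (g : G) (y x : V) :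
    edgeRep ρ g (pointingDiff hT y x) = pointingDiff hT (ρ g y) (ρ g x) := by
  ext d
  change pointing y ((dartPerm T (ρ g)).symm d) - pointing x ((dartPerm T (ρ g)).symm d) =
    pointing (ρ g y) d - pointing (ρ g x) d
  rw [pointing_iso hT.connected, pointing_iso hT.connected]

lemma pointing_of_mem {x : V} {d : T.Dart} (h : x ∈ halfTree d) : pointing x d = 1 :=
  Set.indicator_of_mem h _

lemma pointing_of_notMem {x : V} {d : T.Dart} (h : x ∉ halfTree d) : pointing x d = 0 :=
  Set.indicator_of_notMem h _

lemma eq_or_eq_of_pointing_ne (hT : T.IsTree) {u v : V} (huv : T.Adj u v) {d : T.Dart}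
    (h : pointing u d ≠ pointing v d) : d = ⟨(u, v), huv⟩ ∨ d = ⟨(v, u), huv.symm⟩ := by
  by_cases hu : u ∈ halfTree d <;> by_cases hv : v ∈ halfTree d
  · exact absurd (by rw [pointing_of_mem hu, pointing_of_mem hv]) h
  · obtain ⟨h1, h2⟩ := eq_of_exit hT huv hu hv
    exact Or.inr (SimpleGraph.Dart.ext _ _ (Prod.ext h2.symm h1.symm))
  · obtain ⟨h1, h2⟩ := eq_of_exit hT huv.symm hv hu
    exact Or.inl (SimpleGraph.Dart.ext _ _ (Prod.ext h2.symm h1.symm))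
  · exact absurd (by rw [pointing_of_notMem hu, pointing_of_notMem hv]) h

lemma norm_sq_pointingDiff_of_adj (hT : T.IsTree) {u v : V} (huv : T.Adj u v) :
    ‖pointingDiff hT v u‖ ^ 2 = 2 := by
  classical
  rw [EllTwo.norm_sq_eq_tsum, tsum_eq_sum (s := {⟨(u, v), huv⟩, ⟨(v, u), huv.symm⟩})]
  · have h1 := snd_mem_halfTree (⟨(u, v), huv⟩ : T.Dart)
    have h2 := snd_mem_halfTree (⟨(v, u), huv.symm⟩ : T.Dart)
    have h3 := fst_notMem_halfTree (⟨(u, v), huv⟩ : T.Dart)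
    have h4 := fst_notMem_halfTree (⟨(v, u), huv.symm⟩ : T.Dart)
    rw [Finset.sum_pair fun h => huv.ne (congrArg (fun d : T.Dart => d.fst) h),
      pointingDiff_apply, pointingDiff_apply, pointing_of_mem h1, pointing_of_mem h2,
      pointing_of_notMem h3, pointing_of_notMem h4]
    norm_num
  · intro d hd
    have : pointing u d = pointing v d := by
      by_contra hne
      simpa using (eq_or_eq_of_pointing_ne hT huv hne).elim
        (fun h => hd (by simp [h])) (fun h => hd (by simp [h]))
    rw [pointingDiff_apply, this, sub_self, norm_zero]
    norm_num

lemma norm_sq_pointingDiff (hT : T.IsTree) (y x : V) :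
    ‖pointingDiff hT y x‖ ^ 2 = 2 * (T.dist y x : ℝ) := by
  induction hn : T.dist x y generalizing x with
  | zero =>
    rw [hT.connected.dist_eq_zero_iff] at hn
    rw [hn, pointingDiff_self, T.dist_self]
    simp
  | succ n ih =>
    have hxy : x ≠ y := by
      rintro rfl
      rw [T.dist_self] at hn
      omega
    obtain ⟨z, hxz, hz⟩ := exists_adj_closer hT hxy
    have hd := hT.dist_eq_dist_add_one_of_adj y hxz
    rw [T.dist_comm (u := y), T.dist_comm (u := y)] at hd
    have hzn : T.dist z y = n := by omega
    -- The two summands have disjoint supports: on the edge from `x` to `z` the vertices `y` and `z`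
    -- are on the same side, and on all other edges `x` and `z` are.
    have key : ∀ d, ‖pointingDiff hT y x d‖ ^ 2 =
        ‖pointingDiff hT y z d‖ ^ 2 + ‖pointingDiff hT z x d‖ ^ 2 := by
      intro d
      simp only [pointingDiff_apply]
      by_cases hne : pointing x d = pointing z d
      · simp [hne]
      · have : pointing y d = pointing z d := by
          rcases eq_or_eq_of_pointing_ne hT hxz hne with rfl | rfl
          · have hmem : z ∈ halfTree (⟨(x, z), hxz⟩ : T.Dart) := snd_mem_halfTree _
            rw [pointing_of_mem hmem, pointing_of_mem]
            rwa [mem_halfTree, T.dist_comm, T.dist_comm (u := y)]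
          · have hmem : z ∉ halfTree (⟨(z, x), hxz.symm⟩ : T.Dart) := fst_notMem_halfTree _
            rw [pointing_of_notMem hmem, pointing_of_notMem]
            rw [mem_halfTree, T.dist_comm, T.dist_comm (u := y)]
            exact not_lt.2 hz.le
        simp [this]
    rw [EllTwo.norm_sq_eq_tsum, tsum_congr key, Summable.tsum_add
      (EllTwo.summable_norm_sq _) (EllTwo.summable_norm_sq _), ← EllTwo.norm_sq_eq_tsum,
      ← EllTwo.norm_sq_eq_tsum, ih z hzn, norm_sq_pointingDiff_of_adj hT hxz,
      T.dist_comm (v := x), T.dist_comm (v := z), hn, hzn]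
    push_cast
    ring

/-! ### Elementary actions have trivial reduced class -/

lemma dist_add_le (hT : T.IsTree) {r : ℕ → V} (hr : ∀ n, T.dist (r (n + 1)) (r n) ≤ 1) (m n : ℕ) :
    T.dist (r (n + m)) (r n) ≤ m := by
  induction m with
  | zero => simp
  | succ m ih =>
    have h1 := hT.connected.dist_triangle (u := r (n + (m + 1))) (v := r (n + m)) (w := r n)
    have h2 := hr (n + m)
    rw [add_assoc] at h2
    omega

/-- Cancelling the common terms leaves `p` differences of points at distance at most `N`, each of
norm at most √(2N) ≤ `L`. This growth in √N instead of N makes the averaging work. -/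
lemma norm_sum_pointingDiff_shift_le (hT : T.IsTree) {r : ℕ → V}
    (hr : ∀ n, T.dist (r (n + 1)) (r n) ≤ 1) (p : ℕ) {N L : ℕ} (hL : 2 * N ≤ L ^ 2) :
    ‖∑ n ∈ Finset.range N, pointingDiff hT (r (p + n)) (r n)‖ ≤ p * L := by
  have h1 : ∑ n ∈ Finset.range N, pointingDiff hT (r (p + n)) (r n) =
      ∑ n ∈ Finset.range p, pointingDiff hT (r (n + N)) (r n) := by
    rw [sum_pointingDiff hT (r 0), sum_pointingDiff hT (r 0) (Finset.range p)]
    have h2 := Finset.sum_range_add (fun n => pointingDiff hT (r n) (r 0)) p N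
    have h3 := Finset.sum_range_add (fun n => pointingDiff hT (r n) (r 0)) N p
    rw [add_comm N p, h2] at h3
    simp_rw [add_comm _ N]
    rw [sub_eq_sub_iff_add_eq_add, add_comm, h3, add_comm]
  rw [h1]
  refine (norm_sum_le _ _).trans ((Finset.sum_le_card_nsmul _ _ (L : ℝ) fun n _ => ?_).trans
    (by rw [Finset.card_range, nsmul_eq_mul]))
  refine le_of_sq_le_sq ?_ (Nat.cast_nonneg L)
  rw [norm_sq_pointingDiff]
  exact_mod_cast (Nat.mul_le_mul_left 2 (dist_add_le hT hr N n)).trans hL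

lemma norm_sum_pointingDiff_le (hT : T.IsTree) {r s : ℕ → V}
    (hr : ∀ n, T.dist (r (n + 1)) (r n) ≤ 1) (hs : ∀ n, T.dist (s (n + 1)) (s n) ≤ 1) {p q : ℕ}
    (h : ∀ k, r (p + k) = s (q + k)) {N L : ℕ} (hL : 2 * N ≤ L ^ 2) :
    ‖∑ n ∈ Finset.range N, pointingDiff hT (r n) (s n)‖ ≤ (p + q) * L := by
  have h1 : ∑ n ∈ Finset.range N, pointingDiff hT (r n) (s n) =
      ∑ n ∈ Finset.range N, pointingDiff hT (s (q + n)) (s n) -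
        ∑ n ∈ Finset.range N, pointingDiff hT (r (p + n)) (r n) := by
    rw [← Finset.sum_sub_distrib]
    refine Finset.sum_congr rfl fun n _ => ?_
    rw [h n]
    ext d
    simp only [pointingDiff_apply, lp.coeFn_sub, Pi.sub_apply]
    ring
  rw [h1, add_mul, add_comm]
  exact (norm_sub_le _ _).trans (add_le_add (norm_sum_pointingDiff_shift_le hT hs q hL)
    (norm_sum_pointingDiff_shift_le hT hr p hL))

/-- If `G` permutes a finite family of sequences up to shifts of their tails, then averaging along
the sequences approximates the Haagerup cocycle by coboundaries. -/
lemma reducedClass_eq_zero_of_sequences [TopologicalSpace G] [DiscreteTopology G] (hT : T.IsTree)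
    (ρ : G →* (T ≃g T)) (x₀ : V) {I : Type*} [Fintype I] [Nonempty I] (s : I → ℕ → V)
    (hs : ∀ i n, T.dist (s i (n + 1)) (s i n) ≤ 1) (σ : G → Equiv.Perm I)
    (hσ : ∀ g i, ∃ p q, ∀ k, ρ g (s i (p + k)) = s (σ g i) (q + k)) :
    UnitaryCohomology.reducedClass (edgeRep ρ) (haagerupCocycle hT ρ x₀) = 0 := by
  -- This choice makes 2N the square of 2(M + 1), so the norm estimate needs no rounding of roots.
  let N : ℕ → ℕ := fun M => 2 * (M + 1) ^ 2
  let a : ℕ → ℂ := fun M => ((N M : ℂ) * Fintype.card I)⁻¹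
  let w : ℕ → EllTwo T.Dart := fun M =>
    a M • ∑ i, ∑ n ∈ Finset.range (N M), pointingDiff hT x₀ (s i n)
  refine UnitaryCohomology.reducedClass_eq_zero_of_tendsto w fun g => ?_
  choose p q hpq using hσ g
  have hI : (Fintype.card I : ℂ) ≠ 0 := Nat.cast_ne_zero.2 Fintype.card_ne_zero
  have hN : ∀ M, (N M : ℂ) ≠ 0 := fun M => Nat.cast_ne_zero.2 (by positivity)
  have hb : (haagerupCocycle hT ρ x₀).1 g = pointingDiff hT (ρ g x₀) x₀ := rfl
  -- The terms in `x₀` cancel against the cocycle; reindexing by `σ g` then pairs each translated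
  -- sequence with the one whose tail it shares.
  have hw : ∀ M, (edgeRep ρ g (w M) - w M) - (haagerupCocycle hT ρ x₀).1 g =
      -(a M • ∑ i, ∑ n ∈ Finset.range (N M), pointingDiff hT (ρ g (s i n)) (s (σ g i) n)) := by
    intro M
    have h1 : (haagerupCocycle hT ρ x₀).1 g =
        a M • ∑ i : I, ∑ n ∈ Finset.range (N M), pointingDiff hT (ρ g x₀) x₀ := by
      rw [hb, Finset.sum_const, Finset.sum_const, Finset.card_range, Finset.card_univ,
        ← Nat.cast_smul_eq_nsmul ℂ, ← Nat.cast_smul_eq_nsmul ℂ, smul_smul, smul_smul]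
      have : a M * (Fintype.card I * N M) = 1 := by
        simp only [a]
        have := hN M
        field_simp
      rw [mul_assoc, this, one_smul]
    have h2 : ∑ i, ∑ n ∈ Finset.range (N M), pointingDiff hT (s (σ g i) n) x₀ =
        ∑ i, ∑ n ∈ Finset.range (N M), pointingDiff hT (s i n) x₀ :=
      Equiv.sum_comp (σ g) fun i => ∑ n ∈ Finset.range (N M), pointingDiff hT (s i n) x₀
    have h3 : ∑ i, ∑ n ∈ Finset.range (N M), pointingDiff hT (ρ g (s i n)) (s (σ g i) n) =
        ∑ i, ∑ n ∈ Finset.range (N M), pointingDiff hT (ρ g (s i n)) (s i n) := by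
      have h4 : ∀ u v : I → ℕ → V,
          ∑ i, ∑ n ∈ Finset.range (N M), pointingDiff hT (u i n) (v i n) =
            ∑ i, ∑ n ∈ Finset.range (N M), pointingDiff hT (u i n) x₀ -
              ∑ i, ∑ n ∈ Finset.range (N M), pointingDiff hT (v i n) x₀ := fun u v => by
        rw [← Finset.sum_sub_distrib]
        exact Finset.sum_congr rfl fun i _ => sum_pointingDiff hT x₀ _ _ _
      rw [h4 _ (fun i n => s (σ g i) n), h4 _ (fun i n => s i n), h2]
    rw [h1, h3]
    simp only [w, map_smul, map_sum, edgeRep_pointingDiff]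
    rw [← smul_sub, ← smul_sub, ← smul_neg]
    congr 1
    simp_rw [← Finset.sum_sub_distrib, ← Finset.sum_neg_distrib]
    refine Finset.sum_congr rfl fun i _ => Finset.sum_congr rfl fun n _ => ?_
    ext d
    simp only [pointingDiff_apply, lp.coeFn_sub, lp.coeFn_neg, Pi.sub_apply, Pi.neg_apply]
    ring
  rw [tendsto_iff_norm_sub_tendsto_zero]
  have hlim := (tendsto_one_div_add_atTop_nhds_zero_nat (𝕜 := ℝ)).const_mul
    (∑ i, ((p i : ℝ) + q i))
  rw [mul_zero] at hlim
  refine squeeze_zero (fun _ => norm_nonneg _) (fun M => ?_) hlim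
  rw [hw, norm_neg, norm_smul]
  have hsum : ‖∑ i, ∑ n ∈ Finset.range (N M), pointingDiff hT (ρ g (s i n)) (s (σ g i) n)‖ ≤
      (∑ i, ((p i : ℝ) + q i)) * (2 * (M + 1) : ℕ) := by
    rw [Finset.sum_mul]
    refine (norm_sum_le _ _).trans (Finset.sum_le_sum fun i _ => ?_)
    refine norm_sum_pointingDiff_le hT (r := fun n => ρ g (s i n)) (fun n => ?_) (hs _) (hpq i) ?_
    · rw [dist_iso _ _ _ hT.connected]
      exact hs i n
    · exact le_of_eq (by simp only [N]; ring)
  have ha : ‖a M‖ ≤ (2 * ((M : ℝ) + 1) ^ 2)⁻¹ := by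
    simp only [a, N, norm_inv, norm_mul, Complex.norm_natCast]
    have : (1 : ℝ) ≤ Fintype.card I := by exact_mod_cast Fintype.card_pos
    push_cast
    exact inv_anti₀ (by positivity) (le_mul_of_one_le_right (by positivity) this)
  refine (mul_le_mul ha hsum (norm_nonneg _) (by positivity)).trans (le_of_eq ?_)
  push_cast
  field_simp

lemma Boundary.map_mul (ρ : G →* (T ≃g T)) (g k : G) (ξ : Boundary T) :
    Boundary.map (ρ (g * k)) ξ = Boundary.map (ρ g) (Boundary.map (ρ k) ξ) := by
  induction ξ using Quotient.inductionOn with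
  | _ r =>
    rw [_root_.map_mul]
    rfl

lemma Boundary.map_one (ρ : G →* (T ≃g T)) (ξ : Boundary T) : Boundary.map (ρ 1) ξ = ξ := by
  induction ξ using Quotient.inductionOn with
  | _ r =>
    rw [_root_.map_one]
    rfl

/-- The action of `G` on the vertices. -/
abbrev vertexAction (ρ : G →* (T ≃g T)) : MulAction G V where
  smul g v := ρ g v
  one_smul v := by
    change ρ 1 v = v
    rw [_root_.map_one]
    rfl
  mul_smul g k v := by
    change ρ (g * k) v = ρ g (ρ k v)
    rw [_root_.map_mul]
    rfl

/-- The action of `G` on the boundary. -/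
abbrev boundaryAction (ρ : G →* (T ≃g T)) : MulAction G (Boundary T) where
  smul g ξ := Boundary.map (ρ g) ξ
  one_smul ξ := Boundary.map_one ρ ξ
  mul_smul g k ξ := Boundary.map_mul ρ g k ξ

lemma reducedClass_eq_zero_of_isElementary [TopologicalSpace G] [DiscreteTopology G]
    (hT : T.IsTree) (ρ : G →* (T ≃g T)) (x₀ : V) (h : IsElementary ρ) :
    UnitaryCohomology.reducedClass (edgeRep ρ) (haagerupCocycle hT ρ x₀) = 0 := by
  rcases h with ⟨v, hv⟩ | ⟨ξ, hξ⟩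
  · let _ := vertexAction ρ
    have : Fintype (MulAction.orbit G v) := hv.fintype
    have : Nonempty (MulAction.orbit G v) := ⟨⟨v, MulAction.mem_orbit_self v⟩⟩
    -- Constant sequences are admissible because consecutive terms need only be at distance at most
    -- 1.
    refine reducedClass_eq_zero_of_sequences hT ρ x₀ (I := MulAction.orbit G v)
      (fun i _ => (i : V)) (fun i n => by simp) (fun g => MulAction.toPerm g)
      fun g i => ⟨0, 0, fun k => rfl⟩
  · let _ := boundaryAction ρ
    have : Fintype (MulAction.orbit G ξ) := hξ.fintype
    have : Nonempty (MulAction.orbit G ξ) := ⟨⟨ξ, MulAction.mem_orbit_self ξ⟩⟩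
    have hrep : ∀ η : Boundary T, ∃ r : Ray T, (Quotient.mk _ r : Boundary T) = η :=
      Quotient.exists_rep
    choose rep hrep using hrep
    refine reducedClass_eq_zero_of_sequences hT ρ x₀ (I := MulAction.orbit G ξ)
      (fun i => (rep i).toFun)
      (fun i n => (SimpleGraph.dist_eq_one_iff_adj.2 (Ray.adj _ n).symm).le)
      (fun g => MulAction.toPerm g) fun g i => ?_
    have : Boundary.map (ρ g) (Quotient.mk _ (rep i)) =
        Quotient.mk _ (rep (Boundary.map (ρ g) i)) := by
      rw [hrep, hrep]
    exact Quotient.exact this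

end TreeAction

namespace TreeAction

variable {V : Type*} {T : SimpleGraph V} {G : Type*} [Group G]

/-! ### Negligible sets of vertices -/

/-- The restriction of a function on the oriented edges to the edges that start in `S`. -/
abbrev restrictFst (S : Set V) (f : EllTwo T.Dart) : EllTwo T.Dart :=
  EllTwo.restrict ((fun d : T.Dart => d.fst) ⁻¹' S) f

/-- A set of vertices is negligible if almost invariant functions on the oriented edges have
almost no mass on the edges that start in it. -/
def Negligible (ρ : G →* (T ≃g T)) (S : Set V) : Prop :=
  ∀ ε : ℝ, 0 < ε → ∃ (F : Finset G) (C : ℝ), 0 ≤ C ∧ ∀ f : EllTwo T.Dart,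
    ‖restrictFst S f‖ ≤ ε * ‖f‖ + C * ∑ g ∈ F, ‖edgeRep ρ g f - f‖

namespace Negligible

variable {ρ : G →* (T ≃g T)} {S S' : Set V}

lemma mono (hS : Negligible ρ S) (h : S' ⊆ S) : Negligible ρ S' := fun ε hε => by
  obtain ⟨F, C, hC, hF⟩ := hS ε hε
  exact ⟨F, C, hC, fun f =>
    (EllTwo.norm_restrict_mono (Set.preimage_mono h) f).trans (hF f)⟩

lemma union (hS : Negligible ρ S) (hS' : Negligible ρ S') : Negligible ρ (S ∪ S') := by
  classical
  intro ε hε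
  obtain ⟨F, C, hC, hF⟩ := hS (ε / 2) (half_pos hε)
  obtain ⟨F', C', hC', hF'⟩ := hS' (ε / 2) (half_pos hε)
  refine ⟨F ∪ F', C + C', add_nonneg hC hC', fun f => ?_⟩
  have h1 : ∑ g ∈ F, ‖edgeRep ρ g f - f‖ ≤ ∑ g ∈ F ∪ F', ‖edgeRep ρ g f - f‖ :=
    Finset.sum_le_sum_of_subset_of_nonneg Finset.subset_union_left fun _ _ _ => norm_nonneg _
  have h2 : ∑ g ∈ F', ‖edgeRep ρ g f - f‖ ≤ ∑ g ∈ F ∪ F', ‖edgeRep ρ g f - f‖ :=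
    Finset.sum_le_sum_of_subset_of_nonneg Finset.subset_union_right fun _ _ _ => norm_nonneg _
  have h3 : ‖restrictFst (S ∪ S') f‖ ≤ ‖restrictFst S f‖ + ‖restrictFst S' f‖ :=
    EllTwo.norm_restrict_union_le _ _ f
  have h4 := mul_le_mul_of_nonneg_left h1 hC
  have h5 := mul_le_mul_of_nonneg_left h2 hC'
  have h6 := hF f
  have h7 := hF' f
  rw [add_mul]
  linarith

end Negligible

lemma edgeRep_restrictFst (ρ : G →* (T ≃g T)) (g : G) (S : Set V) (f : EllTwo T.Dart) :
    edgeRep ρ g (restrictFst S f) = restrictFst (ρ g '' S) (edgeRep ρ g f) := by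
  ext d
  obtain ⟨e, rfl⟩ := (dartPerm T (ρ g)).surjective d
  have h1 : ∀ f' : EllTwo T.Dart, edgeRep ρ g f' (dartPerm T (ρ g) e) = f' e := fun f' => by
    change f' ((dartPerm T (ρ g)).symm (dartPerm T (ρ g) e)) = f' e
    rw [Equiv.symm_apply_apply]
  have h2 : (dartPerm T (ρ g) e).fst ∈ ρ g '' S ↔ e.fst ∈ S :=
    (ρ g).injective.mem_set_image
  rw [h1, EllTwo.restrict_apply, EllTwo.restrict_apply]
  by_cases he : e.fst ∈ S
  · rw [Set.indicator_of_mem (by exact he), Set.indicator_of_mem (by exact h2.2 he), h1]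
  · rw [Set.indicator_of_notMem (by exact he),
      Set.indicator_of_notMem (by exact fun h => he (h2.1 h))]

lemma norm_restrictFst_image (ρ : G →* (T ≃g T)) (g : G) (S : Set V) (f : EllTwo T.Dart) :
    ‖restrictFst (ρ g '' S) f‖ = ‖restrictFst S (edgeRep ρ g⁻¹ f)‖ := by
  rw [← (edgeRep ρ g).norm_map (restrictFst S _), edgeRep_restrictFst]
  congr 2
  rw [← Function.comp_apply (f := edgeRep ρ g), ← LinearIsometryEquiv.coe_mul, ← map_mul,
    mul_inv_cancel, map_one]
  rfl

lemma abs_norm_restrictFst_image_sub_le (ρ : G →* (T ≃g T)) (g : G) (S : Set V)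
    (f : EllTwo T.Dart) :
    |‖restrictFst (ρ g '' S) f‖ - ‖restrictFst S f‖| ≤ ‖edgeRep ρ g⁻¹ f - f‖ := by
  rw [norm_restrictFst_image]
  refine (abs_norm_sub_norm_le _ _).trans ?_
  rw [← EllTwo.restrict_sub]
  exact EllTwo.norm_restrict_le _ _

lemma Negligible.image {ρ : G →* (T ≃g T)} {S : Set V} (hS : Negligible ρ S) (g : G) :
    Negligible ρ (ρ g '' S) := by
  classical
  intro ε hε
  obtain ⟨F, C, hC, hF⟩ := hS ε hε
  refine ⟨insert g⁻¹ F, C + 1, by positivity, fun f => ?_⟩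
  have h1 : ∑ g ∈ F, ‖edgeRep ρ g f - f‖ ≤ ∑ g ∈ insert g⁻¹ F, ‖edgeRep ρ g f - f‖ :=
    Finset.sum_le_sum_of_subset_of_nonneg (Finset.subset_insert _ _) fun _ _ _ => norm_nonneg _
  have h2 : ‖edgeRep ρ g⁻¹ f - f‖ ≤ ∑ g ∈ insert g⁻¹ F, ‖edgeRep ρ g f - f‖ :=
    Finset.single_le_sum (f := fun g => ‖edgeRep ρ g f - f‖) (fun _ _ => norm_nonneg _)
      (Finset.mem_insert_self _ _)
  have h3 := mul_le_mul_of_nonneg_left h1 hC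
  have h4 := (abs_le.1 (abs_norm_restrictFst_image_sub_le ρ g S f)).2
  have h5 := hF f
  rw [add_mul]
  linarith

/-- A wandering set is negligible. -/
lemma negligible_of_disjoint {ρ : G →* (T ≃g T)} {S : Set V} (a : G)
    (h : Pairwise fun m n : ℕ => Disjoint (ρ (a ^ m) '' S) (ρ (a ^ n) '' S)) :
    Negligible ρ S := by
  classical
  intro ε hε
  -- The first N translates are disjoint and each carries norm at least ‖f|S‖ - D, so N(‖f|S‖ - D)²
  -- ≤ ‖f‖²; N ≥ ε⁻² suffices.
  obtain ⟨N, hN⟩ := exists_nat_ge ((ε ^ 2)⁻¹)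
  have hN' : 1 ≤ ε ^ 2 * N := by
    have := mul_le_mul_of_nonneg_left hN (sq_nonneg ε)
    rwa [mul_inv_cancel₀ (by positivity)] at this
  refine ⟨(Finset.range N).image fun n => (a ^ n)⁻¹, 1, zero_le_one, fun f => ?_⟩
  set D := ∑ g ∈ (Finset.range N).image fun n => (a ^ n)⁻¹, ‖edgeRep ρ g f - f‖ with hD
  have hk : ∀ n ∈ Finset.range N, ‖restrictFst S f‖ - D ≤ ‖restrictFst (ρ (a ^ n) '' S) f‖ := by
    intro n hn
    have h1 := (abs_le.1 (abs_norm_restrictFst_image_sub_le ρ (a ^ n) S f)).1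
    have h2 : ‖edgeRep ρ (a ^ n)⁻¹ f - f‖ ≤ D :=
      Finset.single_le_sum (f := fun g => ‖edgeRep ρ g f - f‖) (fun _ _ => norm_nonneg _)
        (Finset.mem_image_of_mem _ hn)
    linarith
  rcases le_or_gt (‖restrictFst S f‖ - D) 0 with h0 | h0
  · have := mul_nonneg hε.le (norm_nonneg f)
    linarith
  have h1 : (N : ℝ) * (‖restrictFst S f‖ - D) ^ 2 ≤ ‖f‖ ^ 2 := by
    refine le_trans ?_ (f.sum_norm_restrict_sq_le (Finset.range N)
      (fun n => (fun d : T.Dart => d.fst) ⁻¹' (ρ (a ^ n) '' S)) fun m _ n _ hmn =>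
        (h hmn).preimage _)
    rw [← nsmul_eq_mul, ← Finset.card_range N, ← Finset.sum_const, Finset.card_range]
    exact Finset.sum_le_sum fun n hn => pow_le_pow_left₀ h0.le (hk n hn) 2
  have h2 : (‖restrictFst S f‖ - D) ^ 2 ≤ (ε * ‖f‖) ^ 2 := by
    have h3 := mul_le_mul_of_nonneg_left h1 (sq_nonneg ε)
    have h4 := mul_le_mul_of_nonneg_right hN' (sq_nonneg (‖restrictFst S f‖ - D))
    nlinarith
  have := le_of_sq_le_sq h2 (by positivity)
  linarith

/-- If the set of all vertices is negligible and the Haagerup cocycle is trivial in reduced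
cohomology, then orbits are bounded. -/
lemma Negligible.exists_dist_le [TopologicalSpace G] [DiscreteTopology G] (hT : T.IsTree)
    {ρ : G →* (T ≃g T)} (hV : Negligible ρ Set.univ) (x₀ : V)
    (hb : UnitaryCohomology.reducedClass (edgeRep ρ) (haagerupCocycle hT ρ x₀) = 0) :
    ∃ M : ℕ, ∀ g, T.dist (ρ g x₀) x₀ ≤ M := by
  classical
  obtain ⟨F, C, hC, hF⟩ := hV (1 / 2) (by norm_num)
  set b := haagerupCocycle hT ρ x₀
  let R : ℝ := 2 * (C * ∑ g ∈ F, (‖b.1 g‖ + 1))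
  -- Taking ε = 1/2 above bounds an approximating vector by `R`, which depends on `F` only; `g` is
  -- added to the finite set just to evaluate `b` there.
  have hbound : ∀ g, ‖b.1 g‖ ≤ 2 * R + 1 := by
    intro g
    obtain ⟨v, hv⟩ := UnitaryCohomology.exists_norm_sub_lt_of_reducedClass_eq_zero hb
      (insert g F) one_pos
    have h1 : ‖v‖ ≤ R := by
      have h2 := hF v
      have h3 : restrictFst Set.univ v = v := by
        ext d
        exact congrFun (Set.indicator_univ v) d
      rw [h3] at h2
      have h4 : ∑ g ∈ F, ‖edgeRep ρ g v - v‖ ≤ ∑ g ∈ F, (‖b.1 g‖ + 1) := by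
        refine Finset.sum_le_sum fun k hk => ?_
        have h5 := hv k (Finset.mem_insert_of_mem hk)
        have h6 := norm_sub_norm_le (edgeRep ρ k v - v) (b.1 k)
        rw [norm_sub_rev _ (b.1 k)] at h6
        linarith
      have h5 := mul_le_mul_of_nonneg_left h4 hC
      simp only [R]
      linarith
    have h2 := hv g (Finset.mem_insert_self _ _)
    have h3 := norm_sub_norm_le (b.1 g) (edgeRep ρ g v - v)
    have h4 := norm_sub_le (edgeRep ρ g v) v
    rw [LinearIsometryEquiv.norm_map] at h4
    linarith
  obtain ⟨M, hM⟩ := exists_nat_ge ((2 * R + 1) ^ 2)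
  refine ⟨M, fun g => ?_⟩
  have h1 : ‖b.1 g‖ ^ 2 = 2 * (T.dist (ρ g x₀) x₀ : ℝ) := norm_sq_pointingDiff hT _ _
  have h2 := pow_le_pow_left₀ (norm_nonneg _) (hbound g) 2
  have h3 : (0 : ℝ) ≤ T.dist (ρ g x₀) x₀ := Nat.cast_nonneg _
  have h4 : (T.dist (ρ g x₀) x₀ : ℝ) ≤ M := by linarith
  exact_mod_cast h4

/-! ### Translations -/

/-- The translates of an oriented edge by the powers of a group element. -/
def translate (ρ : G →* (T ≃g T)) (a : G) (h : T.Dart) (n : ℕ) : T.Dart :=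
  dartPerm T (ρ (a ^ n)) h

/-- The oriented edges whose half-trees contain a translate of the half-tree of `h`. -/
def attracting (ρ : G →* (T ≃g T)) (a : G) (h : T.Dart) : Set T.Dart :=
  {e | ∃ n, halfTree (translate ρ a h n) ⊆ halfTree e}

lemma translate_zero (ρ : G →* (T ≃g T)) (a : G) (h : T.Dart) : translate ρ a h 0 = h := by
  rw [translate, pow_zero, dartPerm_one_apply]

lemma dartPerm_pow_translate (ρ : G →* (T ≃g T)) (a : G) (h : T.Dart) (m n : ℕ) :
    dartPerm T (ρ (a ^ m)) (translate ρ a h n) = translate ρ a h (m + n) := by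
  rw [translate, translate, pow_add, dartPerm_mul_apply]

lemma mem_halfTree_translate_add (hT : T.IsTree) (ρ : G →* (T ≃g T)) (a : G) (h : T.Dart)
    (m n : ℕ) (x : V) :
    ρ (a ^ m) x ∈ halfTree (translate ρ a h (m + n)) ↔ x ∈ halfTree (translate ρ a h n) := by
  rw [← dartPerm_pow_translate, mem_halfTree_dartPerm hT]

namespace Skewers

variable {ρ : G →* (T ≃g T)} {a : G} {h : T.Dart}

lemma strictAnti (hs : Skewers ρ a h) (hT : T.IsTree) :
    StrictAnti fun n => halfTree (translate ρ a h n) := by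
  refine strictAnti_nat_of_succ_lt fun n => ?_
  have : translate ρ a h (n + 1) = dartPerm T (ρ (a ^ n)) (dartPerm T (ρ a) h) := by
    rw [translate, pow_succ, dartPerm_mul_apply]
  rw [this, translate]
  exact ⟨(halfTree_dartPerm_subset hT _).2 hs.1,
    fun h' => hs.2 ((halfTree_dartPerm_subset hT _).1 h')⟩

lemma subset (hs : Skewers ρ a h) (hT : T.IsTree) {m n : ℕ} (hmn : m ≤ n) :
    halfTree (translate ρ a h n) ⊆ halfTree (translate ρ a h m) :=
  (hs.strictAnti hT).antitone hmn

/-- The first n + 1 translates are distinct and all separate `x` from `y`; each contributes 1 to the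
squared norm, which is twice the distance. -/
lemma le_two_mul_dist (hs : Skewers ρ a h) (hT : T.IsTree) {x y : V} {n : ℕ}
    (hx : x ∈ halfTree (translate ρ a h n)) (hy : y ∉ halfTree h) : n + 1 ≤ 2 * T.dist x y := by
  have hinj : Function.Injective (translate ρ a h) := fun m n hmn =>
    (hs.strictAnti hT).injective (congrArg halfTree hmn)
  have h1 := lp.sum_rpow_le_norm_rpow (p := 2) (by norm_num) (pointingDiff hT x y)
    ((Finset.range (n + 1)).map ⟨translate ρ a h, hinj⟩)
  rw [Finset.sum_map, Finset.sum_congr rfl (g := fun _ => (1 : ℝ))] at h1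
  · rw [Finset.sum_const, Finset.card_range, nsmul_eq_mul, mul_one, ENNReal.toReal_ofNat,
      Real.rpow_ofNat, norm_sq_pointingDiff] at h1
    exact_mod_cast h1
  · intro k hk
    have hx' := hs.subset hT (Nat.lt_succ_iff.1 (Finset.mem_range.1 hk)) hx
    have hy' : y ∉ halfTree (translate ρ a h k) := fun hy' => hy (by
      have := hs.subset hT (Nat.zero_le k) hy'
      rwa [translate_zero] at this)
    rw [Function.Embedding.coeFn_mk, pointingDiff_apply, pointing_of_mem hx',
      pointing_of_notMem hy']
    simp

lemma exists_forall_notMem (hs : Skewers ρ a h) (hT : T.IsTree) (x : V) :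
    ∃ N, ∀ n, N ≤ n → x ∉ halfTree (translate ρ a h n) := by
  refine ⟨2 * T.dist x h.fst, fun n hn hx => ?_⟩
  have := hs.le_two_mul_dist hT hx (fst_notMem_halfTree h)
  omega

lemma symm (hs : Skewers ρ a h) (hT : T.IsTree) : Skewers ρ a⁻¹ h.symm := by
  have key : dartPerm T (ρ a) (dartPerm T (ρ a⁻¹) h) = h := by
    rw [← dartPerm_mul_apply, mul_inv_cancel, dartPerm_one_apply]
  have h1 : halfTree h ⊆ halfTree (dartPerm T (ρ a⁻¹) h) := by
    rw [← halfTree_dartPerm_subset hT (ρ a), key]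
    exact hs.1
  refine skewers_of_subset hT ?_ fun h2 => hs.2 ?_
  · rw [dartPerm_symm, halfTree_symm_subset_symm hT]
    exact h1
  · rw [dartPerm_symm] at h2
    have h3 := SimpleGraph.Dart.symm_involutive.injective h2
    rw [h3] at key
    rw [key]

/-- This orientation encodes the attracting end of `a`. The nested translates leave every vertex
behind, so a deep one lies on a single side of any given edge. -/
lemma isOrientation (hs : Skewers ρ a h) (hT : T.IsTree) :
    IsOrientation (attracting ρ a h) where
  total e := by
    obtain ⟨n, hn⟩ := hs.exists_forall_notMem hT e.fst
    exact (halfTree_subset_or hT (hn n le_rfl)).imp (fun h => ⟨n, h⟩) fun h => ⟨n, h⟩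
  meet := by
    rintro e ⟨m, hm⟩ f ⟨n, hn⟩
    exact ⟨(translate ρ a h (max m n)).snd,
      hm (hs.subset hT (le_max_left _ _) (snd_mem_halfTree _)),
      hn (hs.subset hT (le_max_right _ _) (snd_mem_halfTree _))⟩

lemma exists_ray (hs : Skewers ρ a h) (hT : T.IsTree) :
    ∃ r : Ray T, r.Follows (attracting ρ a h) := by
  refine (hs.isOrientation hT).exists_ray hT (fun x => ?_) h.fst
  obtain ⟨n, hn⟩ := hs.exists_forall_notMem hT x
  have hx := hn n le_rfl
  have hne : x ≠ (translate ρ a h n).snd := fun heq => hx (heq ▸ snd_mem_halfTree _)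
  obtain ⟨y, hxy, hy⟩ := exists_adj_closer hT hne
  refine ⟨⟨(x, y), hxy⟩, ⟨n, ?_⟩, rfl⟩
  refine halfTree_subset hT (e := ⟨(x, y), hxy⟩) hx (snd_mem_halfTree _) ?_
  rwa [mem_halfTree, T.dist_comm, T.dist_comm (v := x)]

/-- If the reverse of an edge of the ray were chosen, a translate would lie behind that edge, yet
the ray ends up both in it and ahead of the edge. -/
lemma follows_of_eventually (hs : Skewers ρ a h) (hT : T.IsTree) {r : Ray T}
    (hr : ∀ n, ∀ᶠ k in Filter.atTop, r.toFun k ∈ halfTree (translate ρ a h n)) :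
    r.Follows (attracting ρ a h) := by
  intro i
  refine ((hs.isOrientation hT).total (r.dart i)).resolve_right ?_
  rintro ⟨n, hn⟩
  obtain ⟨k, hk, hik⟩ := ((hr n).and (Filter.eventually_gt_atTop i)).exists
  exact (mem_halfTree_symm hT).1 (hn hk) (r.mem_halfTree_dart hT hik)

/-- The strip between `h` and its first translate is disjoint from its images under powers of `a`;
the wider strip is covered by finitely many such images. -/
lemma negligible_diff (hs : Skewers ρ a h) (hT : T.IsTree) (n : ℕ) :
    Negligible ρ (halfTree h \ halfTree (translate ρ a h n)) := by
  have h1 : Negligible ρ (halfTree h \ halfTree (translate ρ a h 1)) := by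
    refine negligible_of_disjoint a ?_
    have hlt : ∀ m n : ℕ, m < n →
        Disjoint (ρ (a ^ m) '' (halfTree h \ halfTree (translate ρ a h 1)))
          (ρ (a ^ n) '' (halfTree h \ halfTree (translate ρ a h 1))) := by
      intro m n hmn
      rw [Set.disjoint_left]
      rintro _ ⟨x, hx, rfl⟩ ⟨y, hy, hxy⟩
      refine hx.2 ((mem_halfTree_translate_add hT ρ a h m 1 x).1 (hs.subset hT hmn ?_))
      rw [← hxy]
      refine (mem_halfTree_translate_add hT ρ a h n 0 y).2 ?_
      rw [translate_zero]
      exact hy.1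
    intro m n hmn
    rcases lt_or_gt_of_ne hmn with h' | h'
    · exact hlt m n h'
    · exact (hlt n m h').symm
  induction n with
  | zero =>
    refine h1.mono ?_
    rw [translate_zero, Set.sdiff_self]
    exact Set.empty_subset _
  | succ n ih =>
    refine (ih.union (h1.image (a ^ n))).mono fun x hx => ?_
    by_cases hxn : x ∈ halfTree (translate ρ a h n)
    · obtain ⟨y, rfl⟩ := (ρ (a ^ n)).surjective x
      refine Or.inr ⟨y, ⟨?_, fun hy => hx.2 ?_⟩, rfl⟩
      · rw [← translate_zero ρ a h]
        exact (mem_halfTree_translate_add hT ρ a h n 0 y).1 hxn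
      · exact (mem_halfTree_translate_add hT ρ a h n 1 y).2 hy
    · exact Or.inl ⟨hx.1, hxn⟩

/-- This two-sided strip is the image under a⁻ᵐ of the part of `h` outside its translate by aᵐ⁺ⁿ. -/
lemma negligible_inter (hs : Skewers ρ a h) (hT : T.IsTree) (m n : ℕ) :
    Negligible ρ (halfTree (translate ρ a h n).symm ∩
      halfTree (translate ρ a⁻¹ h.symm m).symm) := by
  refine ((hs.negligible_diff hT (m + n)).image (a⁻¹ ^ m)).mono fun x hx => ?_
  obtain ⟨y, rfl⟩ := (ρ (a⁻¹ ^ m)).surjective x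
  rw [Set.mem_inter_iff, mem_halfTree_symm hT, mem_halfTree_symm hT] at hx
  refine ⟨y, ⟨?_, fun hy => hx.1 ?_⟩, rfl⟩
  · by_contra hy
    refine hx.2 ((mem_halfTree_translate_add hT ρ a⁻¹ h.symm m 0 y).2 ?_)
    rw [translate_zero]
    exact (mem_halfTree_symm hT).2 hy
  · rw [← mem_halfTree_translate_add hT ρ a h m n, ← RelIso.mul_apply, ← map_mul, inv_pow,
      mul_inv_cancel, map_one]
    exact hy

/-- If some group element moves the attracting end of `a` away from both ends of `a`, then the
half-tree of `h` is negligible. -/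
lemma negligible_halfTree (hs : Skewers ρ a h) (hT : T.IsTree) {r r' : Ray T}
    (hr : r.Follows (attracting ρ a h)) (hr' : r'.Follows (attracting ρ a⁻¹ h.symm)) {k : G}
    (hk : ¬ Ray.map (ρ k) r ≈ r) (hk' : ¬ Ray.map (ρ k) r ≈ r') :
    Negligible ρ (halfTree h) := by
  set s := Ray.map (ρ k) r
  have hs' := hs.symm hT
  -- As `s` tends to neither end of `a`, it eventually stays in a strip bounded by two translates.
  obtain ⟨n, hn⟩ : ∃ n, ¬ ∀ᶠ i in Filter.atTop, s.toFun i ∈ halfTree (translate ρ a h n) := by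
    by_contra! hcon
    exact hk ((hs.isOrientation hT).ray_equiv hT (hs.follows_of_eventually hT hcon) hr)
  obtain ⟨m, hm⟩ : ∃ m, ¬ ∀ᶠ i in Filter.atTop,
      s.toFun i ∈ halfTree (translate ρ a⁻¹ h.symm m) := by
    by_contra! hcon
    exact hk' ((hs'.isOrientation hT).ray_equiv hT (hs'.follows_of_eventually hT hcon) hr')
  have hn' := (s.eventually_or hT _).resolve_left hn
  have hm' := (s.eventually_or hT _).resolve_left hm
  -- For large j the half-tree of k aʲ h misses a vertex of each bounding edge. Since it contains a
  -- tail of `s`, it lies inside the strip.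
  have hout : ∀ x, ∃ N, ∀ j, N ≤ j → x ∉ halfTree (dartPerm T (ρ k) (translate ρ a h j)) := by
    intro x
    obtain ⟨y, rfl⟩ := (ρ k).surjective x
    simp_rw [mem_halfTree_dartPerm hT]
    exact hs.exists_forall_notMem hT y
  obtain ⟨N₁, h₁⟩ := hout (translate ρ a h n).snd
  obtain ⟨N₂, h₂⟩ := hout (translate ρ a⁻¹ h.symm m).snd
  let j := max N₁ N₂
  have hev : ∀ᶠ i in Filter.atTop,
      s.toFun i ∈ halfTree (dartPerm T (ρ k) (translate ρ a h j)) := by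
    have := (hs.isOrientation hT).eventually_mem hT hr (h := translate ρ a h j) ⟨j, subset_rfl⟩
    filter_upwards [this] with i hi
    exact (mem_halfTree_dartPerm hT _ _ _).2 hi
  obtain ⟨i, hi, hin, him⟩ := (hev.and (hn'.and hm')).exists
  have hsub := Set.subset_inter
    (halfTree_subset hT (e := (translate ρ a h n).symm) (h₁ j (le_max_left _ _)) hi hin)
    (halfTree_subset hT (e := (translate ρ a⁻¹ h.symm m).symm) (h₂ j (le_max_right _ _)) hi him)
  -- Pulling back by `k` makes aʲh negligible; the strip between `h` and aʲh completes the
  -- half-tree.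
  have hj := ((hs.negligible_inter hT m n).mono hsub).image k⁻¹
  rw [← halfTree_dartPerm hT, ← dartPerm_mul_apply, inv_mul_cancel, dartPerm_one_apply] at hj
  refine (hj.union (hs.negligible_diff hT j)).mono ?_
  rw [Set.union_sdiff_self]
  exact Set.subset_union_right

/-- An action with a translation is elementary, or the set of all vertices is negligible. -/
lemma isElementary_or_negligible (hs : Skewers ρ a h) (hT : T.IsTree) :
    IsElementary ρ ∨ Negligible ρ (Set.univ : Set V) := by
  obtain ⟨r, hr⟩ := hs.exists_ray hT
  obtain ⟨r', hr'⟩ := (hs.symm hT).exists_ray hT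
  let ξ : Boundary T := Quotient.mk _ r
  let ξ' : Boundary T := Quotient.mk _ r'
  have hfin : ({ξ, ξ'} : Set (Boundary T)).Finite := Set.toFinite _
  by_cases h1 : ∀ k, Ray.map (ρ k) r ≈ r ∨ Ray.map (ρ k) r ≈ r'
  · refine Or.inl (Or.inr ⟨ξ, hfin.subset ?_⟩)
    rintro _ ⟨k, rfl⟩
    exact (h1 k).imp (fun h => Quotient.sound h) fun h => Quotient.sound h
  by_cases h2 : ∀ k, Ray.map (ρ k) r' ≈ r ∨ Ray.map (ρ k) r' ≈ r'
  · refine Or.inl (Or.inr ⟨ξ', hfin.subset ?_⟩)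
    rintro _ ⟨k, rfl⟩
    exact (h2 k).imp (fun h => Quotient.sound h) fun h => Quotient.sound h
  push Not at h1 h2
  obtain ⟨k, hk, hk'⟩ := h1
  obtain ⟨l, hl, hl'⟩ := h2
  right
  have hneg := hs.negligible_halfTree hT hr hr' hk hk'
  have hneg' := (hs.symm hT).negligible_halfTree hT hr' (r' := r)
    (by rwa [inv_inv, SimpleGraph.Dart.symm_symm]) hl' hl
  refine (hneg.union hneg').mono fun x _ => ?_
  rw [Set.mem_union, mem_halfTree_symm hT]
  exact em _

lemma exists_lt_dist (hs : Skewers ρ a h) (hT : T.IsTree) (x : V) (M : ℕ) :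
    ∃ g, M < T.dist (ρ g x) x := by
  obtain ⟨m, hm⟩ := (hs.symm hT).exists_forall_notMem hT x
  obtain ⟨n, hn⟩ := hs.exists_forall_notMem hT x
  have hx : ρ (a ^ m) x ∈ halfTree h := by
    by_contra hcon
    refine hm m le_rfl ?_
    rw [← mem_halfTree_symm hT, ← translate_zero ρ a⁻¹ h.symm,
      ← mem_halfTree_translate_add hT ρ a⁻¹ h.symm m 0, ← RelIso.mul_apply, ← map_mul, inv_pow,
      inv_mul_cancel, map_one] at hcon
    exact hcon
  have hy : ρ (a ^ n)⁻¹ x ∉ halfTree h := by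
    intro hcon
    refine hn n le_rfl ?_
    rw [← translate_zero ρ a h, ← mem_halfTree_translate_add hT ρ a h n 0, ← RelIso.mul_apply,
      ← map_mul, mul_inv_cancel, map_one] at hcon
    exact hcon
  -- The exponent 2M absorbs the factor 2 of `le_two_mul_dist`: from 2M + 1 ≤ 2 dist follows M <
  -- dist.
  have hx' : ρ (a ^ (2 * M)) (ρ (a ^ m) x) ∈ halfTree (translate ρ a h (2 * M)) := by
    refine (mem_halfTree_translate_add hT ρ a h (2 * M) 0 _).2 ?_
    rwa [translate_zero]
  have hd := hs.le_two_mul_dist hT hx' hy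
  refine ⟨a ^ n * (a ^ (2 * M) * a ^ m), ?_⟩
  rw [← dist_iso (ρ (a ^ n)) _ _ hT.connected, ← RelIso.mul_apply, ← RelIso.mul_apply,
    ← RelIso.mul_apply, ← map_mul, ← map_mul, ← map_mul, mul_inv_cancel, map_one,
    mul_assoc] at hd
  change _ ≤ 2 * T.dist _ x at hd
  omega

end Skewers

lemma isElementary_of_reducedClass_eq_zero [TopologicalSpace G] [DiscreteTopology G]
    (hT : T.IsTree) {ρ : G →* (T ≃g T)} (hρ : WithoutInversion ρ) (x₀ : V)
    (hb : UnitaryCohomology.reducedClass (edgeRep ρ) (haagerupCocycle hT ρ x₀) = 0) :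
    IsElementary ρ := by
  by_cases hsk : ∀ g h, ¬ Skewers ρ g h
  · exact isElementary_of_not_skewers hT hρ hsk x₀
  push Not at hsk
  obtain ⟨a, h, hs⟩ := hsk
  refine (hs.isElementary_or_negligible hT).resolve_right fun hV => ?_
  obtain ⟨M, hM⟩ := hV.exists_dist_le hT x₀ hb
  obtain ⟨g, hg⟩ := hs.exists_lt_dist hT x₀ M
  exact absurd (hM g) (not_le.2 hg)

end TreeAction
end

theorem mainTheorem4 {V : Type*} {T : SimpleGraph V} (hT : T.IsTree)
    {G : Type*} [Group G] [TopologicalSpace G] [DiscreteTopology G]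
    (ρ : G →* (T ≃g T)) (hρ : TreeAction.WithoutInversion ρ) (x₀ : V) :
    (∀ g : G, ‖(TreeAction.haagerupCocycle hT ρ x₀).1 g‖ ^ 2 = 2 * (T.dist (ρ g x₀) x₀ : ℝ)) ∧
    (UnitaryCohomology.reducedClass (TreeAction.edgeRep ρ) (TreeAction.haagerupCocycle hT ρ x₀) = 0
      ↔ TreeAction.IsElementary ρ) :=
  ⟨fun g => TreeAction.norm_sq_pointingDiff hT (ρ g x₀) x₀,
    TreeAction.isElementary_of_reducedClass_eq_zero hT hρ x₀,
    TreeAction.reducedClass_eq_zero_of_isElementary hT ρ x₀⟩
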